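/- Let $\mathbf{Cat}$ be the bicategory of categories, functors and natural transformations. For a bicategory $\mathcal B$, let $\mathrm{Arr}(\mathcal B)$ be the displayed bicategory over $\mathcal B$ whose objects over $y$ are 1-cells $h : x \to y$, whose 1-cells over $g : y_1 \to y_2$ from $h_1 : x_1\to y_1$ to $h_2 : x_2 \to y_2$ are pairs of a 1-cell $f : x_1 \to x_2$ and an invertible 2-cell $\gamma : h_1 \cdot g \cong f \cdot h_2$, and whose 2-cells over $\theta : g_1\Rightarrow g_2$ from $(f_1,\gamma_1)$ to $(f_2,\gamma_2)$ are 2-cells $\tau : f_1 \Rightarrow f_2$ with $\gamma_1 \bullet (\tau \vartriangleright h_2) = (h_1 \vartriangleleft \theta) \bullet \gamma_2$ (composition is written in diagrammatic order). A *comprehension bicategory* consists of a bicategory $\mathcal B$, a displayed bicategory $\mathcal D$ over $\mathcal B$ and a displayed pseudofunctor $\chi : \mathcal D \to \mathrm{Arr}(\mathcal B)$ over the identity pseudofunctor of $\mathcal B$, such that 1. $\mathcal D$ has a global cleaving: for every $f : a \to b$ and every $\bar b$ over $b$, a chosen $\bar a$ over $a$ and a chosen displayed 1-cell $\bar a \to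 \bar b$ over $f$ with a cartesian structure. A cartesian structure on $\bar f:\bar a\to\bar b$ over $f$ consists of: for every $h:c\to a$ and every $\bar g : \bar c \to \bar b$ over $h \cdot f$, a lift $(\bar h,\beta)$, that is, a displayed 1-cell $\bar h:\bar c\to\bar a$ over $h$ and an invertible 2-cell $\beta:\bar h \cdot \bar f \cong \bar g$ over $\mathrm{id}_{h \cdot f}$; such that for all lifts $(\bar h_1,\beta_1),(\bar h_2,\beta_2)$ of $(h_1,\bar g_1),(h_2,\bar g_2)$, every $\delta : h_1 \Rightarrow h_2$ and every $\bar\sigma : \bar g_1 \Rightarrow \bar g_2$ over $\delta \vartriangleright f$, there is a unique $\bar\delta : \bar h_1 \Rightarrow \bar h_2$ over $\delta$ with $(\bar\delta \vartriangleright \bar f) \bullet \beta_2 = \beta_1 \bullet \bar\sigma$; 2. $\mathcal D$ has a local opcleaving: for every $\theta : f \Rightarrow g$ and every displayed 1-cell $\bar f$ over $f$, a chosen opcartesian 2-cell over $\theta$ with source $\bar f$. Here $\bar\theta : \bar f \Rightarrow \bar g$ over $\theta$ is opcartesian if for every $\tau : g \Rightarrow h$ and every $\bar\gamma : \bar f \Rightarrow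 \bar h$ over $\theta \bullet \tau$ there is a unique $\bar\tau : \bar g \Rightarrow \bar h$ over $\tau$ with $\bar\theta \bullet \bar\tau = \bar\gamma$; 3. opcartesian 2-cells of $\mathcal D$ are preserved by left and right whiskering; 4. $\chi$ preserves cartesian 1-cells and opcartesian 2-cells. A *contravariant comprehension bicategory* is defined in the same way, with a local cleaving (chosen cartesian 2-cells over $\theta : f\Rightarrow g$ with given target over $g$) and cartesian 2-cells in place of the local opcleaving and opcartesian 2-cells. Let $\mathbf{OpCleav}$ be the displayed bicategory over $\mathbf{Cat}$ whose objects over $C$ are displayed categories over $C$ with an opcleaving (chosen opcartesian lifts of all morphisms of $C$), whose 1-cells over a functor $F$ are the displayed functors over $F$ that preserve opcartesian morphisms, and whose 2-cells over $\theta$ are the displayed natural transformations over $\theta$. Let $\mathbf{Cleav}$ be defined in the same way with cleavings (chosen cartesian lifts) and displayed functors preserving cartesian morphisms. (Displayed categories are taken in the same universes as the categories in $\mathbf{Cat}$, so that their total categories are again objects of $\mathbf{Cat}$.) **Statement.** There is a displayed pseudofunctor $\chi : \mathbf{OpCleav} \to \mathrm{Arr}(\mathbf{Cat})$ over the identity of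 $\mathbf{Cat}$ that sends a displayed category $D$ over $C$ to the projection $\pi_1 : \int D \to C$ of its total category, a displayed functor over $F$ to its total functor (with the identity as invertible 2-cell filling the strictly commuting square with $F$ and the projections), and a displayed natural transformation to its total natural transformation, and $(\mathbf{Cat}, \mathbf{OpCleav}, \chi)$ is a comprehension bicategory. Dually, there is a displayed pseudofunctor $\chi' : \mathbf{Cleav} \to \mathrm{Arr}(\mathbf{Cat})$ over the identity of $\mathbf{Cat}$ given by the same formulas, and $(\mathbf{Cat}, \mathbf{Cleav}, \chi')$ is a contravariant comprehension bicategory. -/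

import Mathlib

open CategoryTheory Bicategory

universe w v u w' v' u' w₁ v₁ u₁ w₂ v₂ u₂ w₃ v₃ u₃ w₄ v₄ u₄

namespace CompBicat

/-! ### Displayed bicategories

All "axioms over axioms" below compare displayed cells lying over two base cells that are equal by
the corresponding axiom of the base. The comparison is written with heterogeneous equality `≍`,
which, the base cells being equal, is the same as equality after transport along that equality. -/

/-- The data of displayed 0-, 1- and 2-cells over a bicategory, with identities, compositions and
whiskerings. -/
structure DispBicatCore (B : Type u) [Bicategory.{w, v} B] where
  Obj : B → Type u'
  Hom : ∀ {a b : B}, (a ⟶ b) → Obj a → Obj b → Type v'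
  Hom₂ : ∀ {a b : B} {f g : a ⟶ b}, (f ⟶ g) → ∀ {x : Obj a} {y : Obj b},
    Hom f x y → Hom g x y → Type w'
  id : ∀ {a : B} (x : Obj a), Hom (𝟙 a) x x
  comp : ∀ {a b c : B} {f : a ⟶ b} {g : b ⟶ c} {x : Obj a} {y : Obj b} {z : Obj c},
    Hom f x y → Hom g y z → Hom (f ≫ g) x z
  id₂ : ∀ {a b : B} {f : a ⟶ b} {x : Obj a} {y : Obj b} (ff : Hom f x y), Hom₂ (𝟙 f) ff ff
  comp₂ : ∀ {a b : B} {f g h : a ⟶ b} {η : f ⟶ g} {θ : g ⟶ h} {x : Obj a} {y : Obj b}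
    {ff : Hom f x y} {gg : Hom g x y} {hh : Hom h x y},
    Hom₂ η ff gg → Hom₂ θ gg hh → Hom₂ (η ≫ θ) ff hh
  whiskerLeft : ∀ {a b c : B} {f : a ⟶ b} {g h : b ⟶ c} {η : g ⟶ h}
    {x : Obj a} {y : Obj b} {z : Obj c} (ff : Hom f x y) {gg : Hom g y z} {hh : Hom h y z},
    Hom₂ η gg hh → Hom₂ (f ◁ η) (comp ff gg) (comp ff hh)
  whiskerRight : ∀ {a b c : B} {f g : a ⟶ b} {h : b ⟶ c} {η : f ⟶ g}
    {x : Obj a} {y : Obj b} {z : Obj c} {ff : Hom f x y} {gg : Hom g x y},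
    Hom₂ η ff gg → ∀ (hh : Hom h y z), Hom₂ (η ▷ h) (comp ff hh) (comp gg hh)

namespace DispBicatCore

variable {B : Type u} [Bicategory.{w, v} B] (D : DispBicatCore.{w, v, u, w', v', u'} B)

/-- A displayed invertible 2-cell over an invertible 2-cell `e` of the base. -/
structure Iso₂ {a b : B} {f g : a ⟶ b} (e : f ≅ g) {x : D.Obj a} {y : D.Obj b}
    (ff : D.Hom f x y) (gg : D.Hom g x y) where
  hom : D.Hom₂ e.hom ff gg
  inv : D.Hom₂ e.inv gg ff
  hom_inv_id : D.comp₂ hom inv ≍ D.id₂ ff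
  inv_hom_id : D.comp₂ inv hom ≍ D.id₂ gg

end DispBicatCore

/-- A displayed bicategory over a bicategory `B`: the structure above with displayed associators
and unitors, subject to the axioms of a bicategory over the axioms of `B`. -/
structure DispBicat (B : Type u) [Bicategory.{w, v} B] extends
    DispBicatCore.{w, v, u, w', v', u'} B where
  associator : ∀ {a b c d : B} {f : a ⟶ b} {g : b ⟶ c} {h : c ⟶ d}
    {x : Obj a} {y : Obj b} {z : Obj c} {t : Obj d}
    (ff : Hom f x y) (gg : Hom g y z) (hh : Hom h z t),
    toDispBicatCore.Iso₂ (α_ f g h) (comp (comp ff gg) hh) (comp ff (comp gg hh))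
  leftUnitor : ∀ {a b : B} {f : a ⟶ b} {x : Obj a} {y : Obj b} (ff : Hom f x y),
    toDispBicatCore.Iso₂ (λ_ f) (comp (id x) ff) ff
  rightUnitor : ∀ {a b : B} {f : a ⟶ b} {x : Obj a} {y : Obj b} (ff : Hom f x y),
    toDispBicatCore.Iso₂ (ρ_ f) (comp ff (id y)) ff
  id_comp₂ : ∀ {a b : B} {f g : a ⟶ b} {η : f ⟶ g} {x : Obj a} {y : Obj b}
    {ff : Hom f x y} {gg : Hom g x y} (ηη : Hom₂ η ff gg), comp₂ (id₂ ff) ηη ≍ ηη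
  comp_id₂ : ∀ {a b : B} {f g : a ⟶ b} {η : f ⟶ g} {x : Obj a} {y : Obj b}
    {ff : Hom f x y} {gg : Hom g x y} (ηη : Hom₂ η ff gg), comp₂ ηη (id₂ gg) ≍ ηη
  assoc₂ : ∀ {a b : B} {f g h k : a ⟶ b} {η : f ⟶ g} {θ : g ⟶ h} {ι : h ⟶ k}
    {x : Obj a} {y : Obj b} {ff : Hom f x y} {gg : Hom g x y} {hh : Hom h x y} {kk : Hom k x y}
    (ηη : Hom₂ η ff gg) (θθ : Hom₂ θ gg hh) (ιι : Hom₂ ι hh kk),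
    comp₂ (comp₂ ηη θθ) ιι ≍ comp₂ ηη (comp₂ θθ ιι)
  whiskerLeft_id : ∀ {a b c : B} {f : a ⟶ b} {g : b ⟶ c} {x : Obj a} {y : Obj b} {z : Obj c}
    (ff : Hom f x y) (gg : Hom g y z), whiskerLeft ff (id₂ gg) ≍ id₂ (comp ff gg)
  whiskerLeft_comp : ∀ {a b c : B} {f : a ⟶ b} {g h i : b ⟶ c} {η : g ⟶ h} {θ : h ⟶ i}
    {x : Obj a} {y : Obj b} {z : Obj c} (ff : Hom f x y)
    {gg : Hom g y z} {hh : Hom h y z} {ii : Hom i y z} (ηη : Hom₂ η gg hh) (θθ : Hom₂ θ hh ii),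
    whiskerLeft ff (comp₂ ηη θθ) ≍ comp₂ (whiskerLeft ff ηη) (whiskerLeft ff θθ)
  id_whiskerLeft : ∀ {a b : B} {f g : a ⟶ b} {η : f ⟶ g} {x : Obj a} {y : Obj b}
    {ff : Hom f x y} {gg : Hom g x y} (ηη : Hom₂ η ff gg),
    whiskerLeft (id x) ηη ≍ comp₂ (leftUnitor ff).hom (comp₂ ηη (leftUnitor gg).inv)
  comp_whiskerLeft : ∀ {a b c d : B} {f : a ⟶ b} {g : b ⟶ c} {h h' : c ⟶ d} {η : h ⟶ h'}
    {x : Obj a} {y : Obj b} {z : Obj c} {t : Obj d} (ff : Hom f x y) (gg : Hom g y z)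
    {hh : Hom h z t} {hh' : Hom h' z t} (ηη : Hom₂ η hh hh'),
    whiskerLeft (comp ff gg) ηη ≍ comp₂ (associator ff gg hh).hom
      (comp₂ (whiskerLeft ff (whiskerLeft gg ηη)) (associator ff gg hh').inv)
  id_whiskerRight : ∀ {a b c : B} {f : a ⟶ b} {g : b ⟶ c} {x : Obj a} {y : Obj b} {z : Obj c}
    (ff : Hom f x y) (gg : Hom g y z), whiskerRight (id₂ ff) gg ≍ id₂ (comp ff gg)
  comp_whiskerRight : ∀ {a b c : B} {f g h : a ⟶ b} {i : b ⟶ c} {η : f ⟶ g} {θ : g ⟶ h}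
    {x : Obj a} {y : Obj b} {z : Obj c} {ff : Hom f x y} {gg : Hom g x y} {hh : Hom h x y}
    (ηη : Hom₂ η ff gg) (θθ : Hom₂ θ gg hh) (ii : Hom i y z),
    whiskerRight (comp₂ ηη θθ) ii ≍ comp₂ (whiskerRight ηη ii) (whiskerRight θθ ii)
  whiskerRight_id : ∀ {a b : B} {f g : a ⟶ b} {η : f ⟶ g} {x : Obj a} {y : Obj b}
    {ff : Hom f x y} {gg : Hom g x y} (ηη : Hom₂ η ff gg),
    whiskerRight ηη (id y) ≍ comp₂ (rightUnitor ff).hom (comp₂ ηη (rightUnitor gg).inv)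
  whiskerRight_comp : ∀ {a b c d : B} {f f' : a ⟶ b} {g : b ⟶ c} {h : c ⟶ d} {η : f ⟶ f'}
    {x : Obj a} {y : Obj b} {z : Obj c} {t : Obj d} {ff : Hom f x y} {ff' : Hom f' x y}
    (ηη : Hom₂ η ff ff') (gg : Hom g y z) (hh : Hom h z t),
    whiskerRight ηη (comp gg hh) ≍ comp₂ (associator ff gg hh).inv
      (comp₂ (whiskerRight (whiskerRight ηη gg) hh) (associator ff' gg hh).hom)
  whisker_assoc : ∀ {a b c d : B} {f : a ⟶ b} {g g' : b ⟶ c} {h : c ⟶ d} {η : g ⟶ g'}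
    {x : Obj a} {y : Obj b} {z : Obj c} {t : Obj d} (ff : Hom f x y)
    {gg : Hom g y z} {gg' : Hom g' y z} (ηη : Hom₂ η gg gg') (hh : Hom h z t),
    whiskerRight (whiskerLeft ff ηη) hh ≍ comp₂ (associator ff gg hh).hom
      (comp₂ (whiskerLeft ff (whiskerRight ηη hh)) (associator ff gg' hh).inv)
  whisker_exchange : ∀ {a b c : B} {f g : a ⟶ b} {h i : b ⟶ c} {η : f ⟶ g} {θ : h ⟶ i}
    {x : Obj a} {y : Obj b} {z : Obj c} {ff : Hom f x y} {gg : Hom g x y}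
    {hh : Hom h y z} {ii : Hom i y z} (ηη : Hom₂ η ff gg) (θθ : Hom₂ θ hh ii),
    comp₂ (whiskerLeft ff θθ) (whiskerRight ηη ii) ≍
      comp₂ (whiskerRight ηη hh) (whiskerLeft gg θθ)
  pentagon : ∀ {a b c d e : B} {f : a ⟶ b} {g : b ⟶ c} {h : c ⟶ d} {i : d ⟶ e}
    {x : Obj a} {y : Obj b} {z : Obj c} {t : Obj d} {s : Obj e}
    (ff : Hom f x y) (gg : Hom g y z) (hh : Hom h z t) (ii : Hom i t s),
    comp₂ (whiskerRight (associator ff gg hh).hom ii)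
        (comp₂ (associator ff (comp gg hh) ii).hom
          (whiskerLeft ff (associator gg hh ii).hom)) ≍
      comp₂ (associator (comp ff gg) hh ii).hom (associator ff gg (comp hh ii)).hom
  triangle : ∀ {a b c : B} {f : a ⟶ b} {g : b ⟶ c} {x : Obj a} {y : Obj b} {z : Obj c}
    (ff : Hom f x y) (gg : Hom g y z),
    comp₂ (associator ff (id y) gg).hom (whiskerLeft ff (leftUnitor gg).hom) ≍
      whiskerRight (rightUnitor ff).hom gg

namespace DispBicat

variable {B : Type u} [Bicategory.{w, v} B] (D : DispBicat.{w, v, u, w', v', u'} B)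

/-- The displayed bicategory obtained from `D` by equipping the displayed objects with a structure
`P₀`, keeping only those displayed 1-cells that satisfy a predicate `P₁`, and keeping all displayed
2-cells between them. -/
def restrict (P₀ : ∀ {a : B}, D.Obj a → Type u₁)
    (P₁ : ∀ {a b : B} {f : a ⟶ b} {x : D.Obj a} {y : D.Obj b}, D.Hom f x y → Prop)
    (hid : ∀ {a : B} (x : D.Obj a), P₁ (D.id x))
    (hcomp : ∀ {a b c : B} {f : a ⟶ b} {g : b ⟶ c} {x : D.Obj a} {y : D.Obj b} {z : D.Obj c}
      (ff : D.Hom f x y) (gg : D.Hom g y z), P₁ ff → P₁ gg → P₁ (D.comp ff gg)) :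
    DispBicat.{w, v, u, w', v', max u' u₁} B where
  Obj a := Σ x : D.Obj a, P₀ x
  Hom f x y := {ff : D.Hom f x.1 y.1 // P₁ ff}
  Hom₂ θ _ _ ff gg := D.Hom₂ θ ff.1 gg.1
  id x := ⟨D.id x.1, hid x.1⟩
  comp ff gg := ⟨D.comp ff.1 gg.1, hcomp ff.1 gg.1 ff.2 gg.2⟩
  id₂ ff := D.id₂ ff.1
  comp₂ ηη θθ := D.comp₂ ηη θθ
  whiskerLeft ff _ _ ηη := D.whiskerLeft ff.1 ηη
  whiskerRight ηη hh := D.whiskerRight ηη hh.1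
  associator ff gg hh :=
    { hom := (D.associator ff.1 gg.1 hh.1).hom
      inv := (D.associator ff.1 gg.1 hh.1).inv
      hom_inv_id := (D.associator ff.1 gg.1 hh.1).hom_inv_id
      inv_hom_id := (D.associator ff.1 gg.1 hh.1).inv_hom_id }
  leftUnitor ff :=
    { hom := (D.leftUnitor ff.1).hom
      inv := (D.leftUnitor ff.1).inv
      hom_inv_id := (D.leftUnitor ff.1).hom_inv_id
      inv_hom_id := (D.leftUnitor ff.1).inv_hom_id }
  rightUnitor ff :=
    { hom := (D.rightUnitor ff.1).hom
      inv := (D.rightUnitor ff.1).inv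
      hom_inv_id := (D.rightUnitor ff.1).hom_inv_id
      inv_hom_id := (D.rightUnitor ff.1).inv_hom_id }
  id_comp₂ ηη := D.id_comp₂ ηη
  comp_id₂ ηη := D.comp_id₂ ηη
  assoc₂ ηη θθ ιι := D.assoc₂ ηη θθ ιι
  whiskerLeft_id ff gg := D.whiskerLeft_id ff.1 gg.1
  whiskerLeft_comp ff _ _ _ ηη θθ := D.whiskerLeft_comp ff.1 ηη θθ
  id_whiskerLeft ηη := D.id_whiskerLeft ηη
  comp_whiskerLeft ff gg _ _ ηη := D.comp_whiskerLeft ff.1 gg.1 ηη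
  id_whiskerRight ff gg := D.id_whiskerRight ff.1 gg.1
  comp_whiskerRight ηη θθ ii := D.comp_whiskerRight ηη θθ ii.1
  whiskerRight_id ηη := D.whiskerRight_id ηη
  whiskerRight_comp ηη gg hh := D.whiskerRight_comp ηη gg.1 hh.1
  whisker_assoc ff _ _ ηη hh := D.whisker_assoc ff.1 ηη hh.1
  whisker_exchange ηη θθ := D.whisker_exchange ηη θθ
  pentagon ff gg hh ii := D.pentagon ff.1 gg.1 hh.1 ii.1
  triangle ff gg := D.triangle ff.1 gg.1

/-! ### Cartesian 1-cells, (op)cartesian 2-cells, cleavings -/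

variable {D}

/-- A lift of `(h, gg)` along `ff`: a displayed 1-cell `hom` over `h` with a displayed invertible
2-cell from `hom ≫ ff` to `gg` over the identity of `h ≫ f`. -/
structure Lift {a b c : B} {f : a ⟶ b} {x : D.Obj a} {y : D.Obj b} (ff : D.Hom f x y)
    {z : D.Obj c} (h : c ⟶ a) (gg : D.Hom (h ≫ f) z y) where
  hom : D.Hom h z x
  iso : D.Iso₂ (Iso.refl (h ≫ f)) (D.comp hom ff) gg

/-- A cartesian structure on a displayed 1-cell. -/
structure CartesianStructure {a b : B} {f : a ⟶ b} {x : D.Obj a} {y : D.Obj b}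
    (ff : D.Hom f x y) where
  lift : ∀ {c : B} {z : D.Obj c} (h : c ⟶ a) (gg : D.Hom (h ≫ f) z y), Lift ff h gg
  existsUnique_lift₂ : ∀ {c : B} {z : D.Obj c} {h₁ h₂ : c ⟶ a}
    {gg₁ : D.Hom (h₁ ≫ f) z y} {gg₂ : D.Hom (h₂ ≫ f) z y}
    (L₁ : Lift ff h₁ gg₁) (L₂ : Lift ff h₂ gg₂) (δ : h₁ ⟶ h₂) (σσ : D.Hom₂ (δ ▷ f) gg₁ gg₂),
    ∃! δδ : D.Hom₂ δ L₁.hom L₂.hom,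
      D.comp₂ (D.whiskerRight δδ ff) L₂.iso.hom ≍ D.comp₂ L₁.iso.hom σσ

/-- Opcartesian displayed 2-cells. -/
def IsOpcartesian₂ {a b : B} {f g : a ⟶ b} {θ : f ⟶ g} {x : D.Obj a} {y : D.Obj b}
    {ff : D.Hom f x y} {gg : D.Hom g x y} (θθ : D.Hom₂ θ ff gg) : Prop :=
  ∀ {h : a ⟶ b} {hh : D.Hom h x y} (τ : g ⟶ h) (γγ : D.Hom₂ (θ ≫ τ) ff hh),
    ∃! ττ : D.Hom₂ τ gg hh, D.comp₂ θθ ττ = γγ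

/-- Cartesian displayed 2-cells. -/
def IsCartesian₂ {a b : B} {f g : a ⟶ b} {θ : f ⟶ g} {x : D.Obj a} {y : D.Obj b}
    {ff : D.Hom f x y} {gg : D.Hom g x y} (θθ : D.Hom₂ θ ff gg) : Prop :=
  ∀ {h : a ⟶ b} {hh : D.Hom h x y} (τ : h ⟶ f) (γγ : D.Hom₂ (τ ≫ θ) hh gg),
    ∃! ττ : D.Hom₂ τ hh ff, D.comp₂ ττ θθ = γγ

variable (D)

/-- A global cleaving: chosen cartesian lifts of 1-cells. -/
structure GlobalCleaving where
  obj : ∀ {a b : B} (_ : a ⟶ b) (_ : D.Obj b), D.Obj a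
  hom : ∀ {a b : B} (f : a ⟶ b) (y : D.Obj b), D.Hom f (obj f y) y
  cartesian : ∀ {a b : B} (f : a ⟶ b) (y : D.Obj b), CartesianStructure (hom f y)

/-- A local opcleaving: chosen opcartesian lifts of 2-cells with given source. -/
structure LocalOpcleaving where
  hom : ∀ {a b : B} {f g : a ⟶ b} (_ : f ⟶ g) {x : D.Obj a} {y : D.Obj b} (_ : D.Hom f x y),
    D.Hom g x y
  hom₂ : ∀ {a b : B} {f g : a ⟶ b} (θ : f ⟶ g) {x : D.Obj a} {y : D.Obj b} (ff : D.Hom f x y),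
    D.Hom₂ θ ff (hom θ ff)
  opcartesian : ∀ {a b : B} {f g : a ⟶ b} (θ : f ⟶ g) {x : D.Obj a} {y : D.Obj b}
    (ff : D.Hom f x y), IsOpcartesian₂ (hom₂ θ ff)

/-- A local cleaving: chosen cartesian lifts of 2-cells with given target. -/
structure LocalCleaving where
  hom : ∀ {a b : B} {f g : a ⟶ b} (_ : f ⟶ g) {x : D.Obj a} {y : D.Obj b} (_ : D.Hom g x y),
    D.Hom f x y
  hom₂ : ∀ {a b : B} {f g : a ⟶ b} (θ : f ⟶ g) {x : D.Obj a} {y : D.Obj b} (gg : D.Hom g x y),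
    D.Hom₂ θ (hom θ gg) gg
  cartesian : ∀ {a b : B} {f g : a ⟶ b} (θ : f ⟶ g) {x : D.Obj a} {y : D.Obj b}
    (gg : D.Hom g x y), IsCartesian₂ (hom₂ θ gg)

end DispBicat

/-! ### The displayed bicategory of arrows -/

section Arrows

variable {B : Type u} [Bicategory.{w, v} B]

/-- An arrow with codomain `y`. -/
structure ArrowObj (y : B) where
  dom : B
  arr : dom ⟶ y

/-- A square over `g` that commutes up to a given invertible 2-cell. -/
structure ArrowHom {y₁ y₂ : B} (g : y₁ ⟶ y₂) (h₁ : ArrowObj y₁) (h₂ : ArrowObj y₂) where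
  top : h₁.dom ⟶ h₂.dom
  iso : h₁.arr ≫ g ≅ top ≫ h₂.arr

/-- A 2-cell between the top sides of two squares, compatible with `θ`. -/
@[ext]
structure ArrowHom₂ {y₁ y₂ : B} {g₁ g₂ : y₁ ⟶ y₂} (θ : g₁ ⟶ g₂) {h₁ : ArrowObj y₁}
    {h₂ : ArrowObj y₂} (s₁ : ArrowHom g₁ h₁ h₂) (s₂ : ArrowHom g₂ h₁ h₂) where
  top : s₁.top ⟶ s₂.top
  comm : s₁.iso.hom ≫ top ▷ h₂.arr = h₁.arr ◁ θ ≫ s₂.iso.hom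

theorem ArrowHom₂.hext {y₁ y₂ : B} {g₁ g₂ : y₁ ⟶ y₂} {θ θ' : g₁ ⟶ g₂} {h₁ : ArrowObj y₁}
    {h₂ : ArrowObj y₂} {s₁ : ArrowHom g₁ h₁ h₂} {s₂ : ArrowHom g₂ h₁ h₂}
    {τ : ArrowHom₂ θ s₁ s₂} {τ' : ArrowHom₂ θ' s₁ s₂} (h : θ = θ') (ht : τ.top = τ'.top) :
    τ ≍ τ' := by
  subst h
  exact heq_of_eq (ArrowHom₂.ext ht)

/-- The identity square. -/
def ArrowHom.id {y : B} (h : ArrowObj y) : ArrowHom (𝟙 y) h h where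
  top := 𝟙 h.dom
  iso := ρ_ h.arr ≪≫ (λ_ h.arr).symm

/-- Pasting of squares. -/
def ArrowHom.comp {y₁ y₂ y₃ : B} {g : y₁ ⟶ y₂} {g' : y₂ ⟶ y₃} {h₁ : ArrowObj y₁}
    {h₂ : ArrowObj y₂} {h₃ : ArrowObj y₃} (s : ArrowHom g h₁ h₂) (s' : ArrowHom g' h₂ h₃) :
    ArrowHom (g ≫ g') h₁ h₃ where
  top := s.top ≫ s'.top
  iso := (α_ h₁.arr g g').symm ≪≫ whiskerRightIso s.iso g' ≪≫ α_ s.top h₂.arr g' ≪≫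
    whiskerLeftIso s.top s'.iso ≪≫ (α_ s.top s'.top h₃.arr).symm

theorem ArrowHom₂.comm_whiskerLeft {a b c : B} {f : a ⟶ b} {g g' : b ⟶ c} {η : g ⟶ g'}
    {x : ArrowObj a} {y : ArrowObj b} {z : ArrowObj c} (s : ArrowHom f x y)
    {t : ArrowHom g y z} {t' : ArrowHom g' y z} (τ : ArrowHom₂ η t t') :
    (s.comp t).iso.hom ≫ (s.top ◁ τ.top) ▷ z.arr =
      x.arr ◁ (f ◁ η) ≫ (s.comp t').iso.hom := by
  have h := τ.comm
  have e : s.top ◁ t.iso.hom ≫ s.top ◁ (τ.top ▷ z.arr) =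
      s.top ◁ (y.arr ◁ η) ≫ s.top ◁ t'.iso.hom := by
    rw [← whiskerLeft_comp, h, whiskerLeft_comp]
  have e2 : s.iso.hom ▷ g ≫ (s.top ≫ y.arr) ◁ η = (x.arr ≫ f) ◁ η ≫ s.iso.hom ▷ g' :=
    (whisker_exchange _ _).symm
  rw [comp_whiskerLeft, comp_whiskerLeft] at e2
  have e2' := congrArg (fun k => (α_ x.arr f g).inv ≫ k ≫ (α_ s.top y.arr g').hom) e2
  simp only [Category.assoc, Iso.inv_hom_id, Category.comp_id, Iso.inv_hom_id_assoc] at e2'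
  simp only [ArrowHom.comp, Iso.trans_hom, Iso.symm_hom, whiskerRightIso_hom, whiskerLeftIso_hom,
    Category.assoc, whisker_assoc, Iso.inv_hom_id_assoc]
  rw [reassoc_of% e, reassoc_of% e2']

theorem ArrowHom₂.comm_whiskerRight {a b c : B} {f f' : a ⟶ b} {g : b ⟶ c} {η : f ⟶ f'}
    {x : ArrowObj a} {y : ArrowObj b} {z : ArrowObj c} {s : ArrowHom f x y}
    {s' : ArrowHom f' x y} (τ : ArrowHom₂ η s s') (t : ArrowHom g y z) :
    (s.comp t).iso.hom ≫ (τ.top ▷ t.top) ▷ z.arr =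
      x.arr ◁ (η ▷ g) ≫ (s'.comp t).iso.hom := by
  have e : s.iso.hom ▷ g ≫ (τ.top ▷ y.arr) ▷ g = (x.arr ◁ η) ▷ g ≫ s'.iso.hom ▷ g := by
    rw [← comp_whiskerRight, τ.comm, comp_whiskerRight]
  have e2 : s.top ◁ t.iso.hom ≫ τ.top ▷ (t.top ≫ z.arr) =
      τ.top ▷ (y.arr ≫ g) ≫ s'.top ◁ t.iso.hom := whisker_exchange _ _
  rw [whiskerRight_comp, whiskerRight_comp] at e2
  have e2' := congrArg (fun k => (α_ s.top y.arr g).hom ≫ k ≫ (α_ s'.top t.top z.arr).inv) e2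
  simp only [Category.assoc, Iso.hom_inv_id, Category.comp_id, Iso.hom_inv_id_assoc] at e2'
  simp only [ArrowHom.comp, Iso.trans_hom, Iso.symm_hom, whiskerRightIso_hom, whiskerLeftIso_hom,
    Category.assoc]
  rw [e2', reassoc_of% e]
  simp

theorem ArrowHom₂.comm_associator {a b c d : B} {f : a ⟶ b} {g : b ⟶ c} {h : c ⟶ d}
    {x : ArrowObj a} {y : ArrowObj b} {z : ArrowObj c} {w : ArrowObj d}
    (s : ArrowHom f x y) (t : ArrowHom g y z) (r : ArrowHom h z w) :
    ((s.comp t).comp r).iso.hom ≫ (α_ s.top t.top r.top).hom ▷ w.arr =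
      x.arr ◁ (α_ f g h).hom ≫ (s.comp (t.comp r)).iso.hom := by
  simp [ArrowHom.comp]

theorem ArrowHom₂.comm_leftUnitor {a b : B} {f : a ⟶ b} {x : ArrowObj a} {y : ArrowObj b}
    (s : ArrowHom f x y) :
    ((ArrowHom.id x).comp s).iso.hom ≫ (λ_ s.top).hom ▷ y.arr =
      x.arr ◁ (λ_ f).hom ≫ s.iso.hom := by
  simp [ArrowHom.comp, ArrowHom.id]

theorem ArrowHom₂.comm_rightUnitor {a b : B} {f : a ⟶ b} {x : ArrowObj a} {y : ArrowObj b}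
    (s : ArrowHom f x y) :
    (s.comp (ArrowHom.id y)).iso.hom ≫ (ρ_ s.top).hom ▷ y.arr =
      x.arr ◁ (ρ_ f).hom ≫ s.iso.hom := by
  simp [ArrowHom.comp, ArrowHom.id]

theorem ArrowHom₂.comm_inv {a b : B} {f g : a ⟶ b} (e : f ≅ g) {x : ArrowObj a}
    {y : ArrowObj b} {s : ArrowHom f x y} {t : ArrowHom g x y} (e' : s.top ≅ t.top)
    (h : s.iso.hom ≫ e'.hom ▷ y.arr = x.arr ◁ e.hom ≫ t.iso.hom) :
    t.iso.hom ≫ e'.inv ▷ y.arr = x.arr ◁ e.inv ≫ s.iso.hom := by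
  rw [← cancel_epi (x.arr ◁ e.hom), ← Category.assoc, ← h]
  simp

variable (B)

/-- The data of the displayed bicategory of arrows of `B`. -/
def arrowCore : DispBicatCore.{w, v, u, w, max w v, max u v} B where
  Obj y := ArrowObj y
  Hom g h₁ h₂ := ArrowHom g h₁ h₂
  Hom₂ θ _ _ s₁ s₂ := ArrowHom₂ θ s₁ s₂
  id h := ArrowHom.id h
  comp s s' := s.comp s'
  id₂ s := ⟨𝟙 s.top, by simp⟩
  comp₂ τ τ' := ⟨τ.top ≫ τ'.top, by
    rw [comp_whiskerRight, ← Category.assoc, τ.comm, Category.assoc, τ'.comm,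
      whiskerLeft_comp, Category.assoc]⟩
  whiskerLeft s _ _ τ := ⟨s.top ◁ τ.top, ArrowHom₂.comm_whiskerLeft s τ⟩
  whiskerRight τ s := ⟨τ.top ▷ s.top, ArrowHom₂.comm_whiskerRight τ s⟩

/-- The displayed bicategory of arrows of `B`; its projection is the codomain. -/
def arrow : DispBicat.{w, v, u, w, max w v, max u v} B where
  toDispBicatCore := arrowCore B
  associator s s' s'' :=
    { hom := ⟨(α_ s.top s'.top s''.top).hom, ArrowHom₂.comm_associator s s' s''⟩
      inv := ⟨(α_ s.top s'.top s''.top).inv,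
        ArrowHom₂.comm_inv (α_ _ _ _) (s := (s.comp s').comp s'') (t := s.comp (s'.comp s''))
          (α_ s.top s'.top s''.top) (ArrowHom₂.comm_associator s s' s'')⟩
      hom_inv_id := ArrowHom₂.hext (Iso.hom_inv_id _) (Iso.hom_inv_id _)
      inv_hom_id := ArrowHom₂.hext (Iso.inv_hom_id _) (Iso.inv_hom_id _) }
  leftUnitor s :=
    { hom := ⟨(λ_ s.top).hom, ArrowHom₂.comm_leftUnitor s⟩
      inv := ⟨(λ_ s.top).inv, ArrowHom₂.comm_inv _ _ (ArrowHom₂.comm_leftUnitor s)⟩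
      hom_inv_id := ArrowHom₂.hext (Iso.hom_inv_id _) (Iso.hom_inv_id _)
      inv_hom_id := ArrowHom₂.hext (Iso.inv_hom_id _) (Iso.inv_hom_id _) }
  rightUnitor s :=
    { hom := ⟨(ρ_ s.top).hom, ArrowHom₂.comm_rightUnitor s⟩
      inv := ⟨(ρ_ s.top).inv, ArrowHom₂.comm_inv _ _ (ArrowHom₂.comm_rightUnitor s)⟩
      hom_inv_id := ArrowHom₂.hext (Iso.hom_inv_id _) (Iso.hom_inv_id _)
      inv_hom_id := ArrowHom₂.hext (Iso.inv_hom_id _) (Iso.inv_hom_id _) }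
  id_comp₂ _ := ArrowHom₂.hext (Category.id_comp _) (Category.id_comp _)
  comp_id₂ _ := ArrowHom₂.hext (Category.comp_id _) (Category.comp_id _)
  assoc₂ _ _ _ := ArrowHom₂.hext (Category.assoc ..) (Category.assoc ..)
  whiskerLeft_id _ _ := ArrowHom₂.hext (whiskerLeft_id ..) (whiskerLeft_id ..)
  whiskerLeft_comp _ _ _ _ _ _ := ArrowHom₂.hext (whiskerLeft_comp ..) (whiskerLeft_comp ..)
  id_whiskerLeft _ := ArrowHom₂.hext (id_whiskerLeft ..) (id_whiskerLeft ..)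
  comp_whiskerLeft _ _ _ _ _ := ArrowHom₂.hext (comp_whiskerLeft ..) (comp_whiskerLeft ..)
  id_whiskerRight _ _ := ArrowHom₂.hext (id_whiskerRight ..) (id_whiskerRight ..)
  comp_whiskerRight _ _ _ := ArrowHom₂.hext (comp_whiskerRight ..) (comp_whiskerRight ..)
  whiskerRight_id _ := ArrowHom₂.hext (whiskerRight_id ..) (whiskerRight_id ..)
  whiskerRight_comp _ _ _ := ArrowHom₂.hext (whiskerRight_comp ..) (whiskerRight_comp ..)
  whisker_assoc _ _ _ _ _ := ArrowHom₂.hext (whisker_assoc ..) (whisker_assoc ..)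
  whisker_exchange _ _ := ArrowHom₂.hext (whisker_exchange ..) (whisker_exchange ..)
  pentagon _ _ _ _ := ArrowHom₂.hext (pentagon ..) (pentagon ..)
  triangle _ _ := ArrowHom₂.hext (triangle ..) (triangle ..)

end Arrows

/-! ### Displayed pseudofunctors -/

section DispPseudofunctors

variable {B : Type u₁} [Bicategory.{w₁, v₁} B] {B' : Type u₂} [Bicategory.{w₂, v₂} B']

/-- The action on displayed 0-, 1- and 2-cells of a displayed pseudofunctor over `F`. -/
structure DispCellMap (F : Pseudofunctor B B') (D : DispBicat.{w₁, v₁, u₁, w₃, v₃, u₃} B)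
    (D' : DispBicat.{w₂, v₂, u₂, w₄, v₄, u₄} B') where
  obj : ∀ {a : B}, D.Obj a → D'.Obj (F.obj a)
  map : ∀ {a b : B} {f : a ⟶ b} {x : D.Obj a} {y : D.Obj b},
    D.Hom f x y → D'.Hom (F.map f) (obj x) (obj y)
  map₂ : ∀ {a b : B} {f g : a ⟶ b} {θ : f ⟶ g} {x : D.Obj a} {y : D.Obj b}
    {ff : D.Hom f x y} {gg : D.Hom g x y}, D.Hom₂ θ ff gg → D'.Hom₂ (F.map₂ θ) (map ff) (map gg)

/-- Displayed pseudofunctors over a pseudofunctor `F`. -/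
structure DispPseudofunctor (F : Pseudofunctor B B')
    (D : DispBicat.{w₁, v₁, u₁, w₃, v₃, u₃} B) (D' : DispBicat.{w₂, v₂, u₂, w₄, v₄, u₄} B')
    extends DispCellMap F D D' where
  mapId : ∀ {a : B} (x : D.Obj a), D'.Iso₂ (F.mapId a) (map (D.id x)) (D'.id (obj x))
  mapComp : ∀ {a b c : B} {f : a ⟶ b} {g : b ⟶ c} {x : D.Obj a} {y : D.Obj b} {z : D.Obj c}
    (ff : D.Hom f x y) (gg : D.Hom g y z),
    D'.Iso₂ (F.mapComp f g) (map (D.comp ff gg)) (D'.comp (map ff) (map gg))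
  map₂_id : ∀ {a b : B} {f : a ⟶ b} {x : D.Obj a} {y : D.Obj b} (ff : D.Hom f x y),
    map₂ (D.id₂ ff) ≍ D'.id₂ (map ff)
  map₂_comp : ∀ {a b : B} {f g h : a ⟶ b} {η : f ⟶ g} {θ : g ⟶ h} {x : D.Obj a} {y : D.Obj b}
    {ff : D.Hom f x y} {gg : D.Hom g x y} {hh : D.Hom h x y}
    (ηη : D.Hom₂ η ff gg) (θθ : D.Hom₂ θ gg hh),
    map₂ (D.comp₂ ηη θθ) ≍ D'.comp₂ (map₂ ηη) (map₂ θθ)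
  map₂_whiskerLeft : ∀ {a b c : B} {f : a ⟶ b} {g h : b ⟶ c} {η : g ⟶ h}
    {x : D.Obj a} {y : D.Obj b} {z : D.Obj c} (ff : D.Hom f x y)
    {gg : D.Hom g y z} {hh : D.Hom h y z} (ηη : D.Hom₂ η gg hh),
    map₂ (D.whiskerLeft ff ηη) ≍ D'.comp₂ (mapComp ff gg).hom
      (D'.comp₂ (D'.whiskerLeft (map ff) (map₂ ηη)) (mapComp ff hh).inv)
  map₂_whiskerRight : ∀ {a b c : B} {f g : a ⟶ b} {h : b ⟶ c} {η : f ⟶ g}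
    {x : D.Obj a} {y : D.Obj b} {z : D.Obj c} {ff : D.Hom f x y} {gg : D.Hom g x y}
    (ηη : D.Hom₂ η ff gg) (hh : D.Hom h y z),
    map₂ (D.whiskerRight ηη hh) ≍ D'.comp₂ (mapComp ff hh).hom
      (D'.comp₂ (D'.whiskerRight (map₂ ηη) (map hh)) (mapComp gg hh).inv)
  map₂_associator : ∀ {a b c d : B} {f : a ⟶ b} {g : b ⟶ c} {h : c ⟶ d}
    {x : D.Obj a} {y : D.Obj b} {z : D.Obj c} {t : D.Obj d}
    (ff : D.Hom f x y) (gg : D.Hom g y z) (hh : D.Hom h z t),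
    map₂ (D.associator ff gg hh).hom ≍ D'.comp₂ (mapComp (D.comp ff gg) hh).hom
      (D'.comp₂ (D'.whiskerRight (mapComp ff gg).hom (map hh))
        (D'.comp₂ (D'.associator (map ff) (map gg) (map hh)).hom
          (D'.comp₂ (D'.whiskerLeft (map ff) (mapComp gg hh).inv)
            (mapComp ff (D.comp gg hh)).inv)))
  map₂_leftUnitor : ∀ {a b : B} {f : a ⟶ b} {x : D.Obj a} {y : D.Obj b} (ff : D.Hom f x y),
    map₂ (D.leftUnitor ff).hom ≍ D'.comp₂ (mapComp (D.id x) ff).hom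
      (D'.comp₂ (D'.whiskerRight (mapId x).hom (map ff)) (D'.leftUnitor (map ff)).hom)
  map₂_rightUnitor : ∀ {a b : B} {f : a ⟶ b} {x : D.Obj a} {y : D.Obj b} (ff : D.Hom f x y),
    map₂ (D.rightUnitor ff).hom ≍ D'.comp₂ (mapComp ff (D.id y)).hom
      (D'.comp₂ (D'.whiskerLeft (map ff) (mapId y).hom) (D'.rightUnitor (map ff)).hom)

namespace DispCellMap

variable {F : Pseudofunctor B B'} {D : DispBicat.{w₁, v₁, u₁, w₃, v₃, u₃} B}
  {D' : DispBicat.{w₂, v₂, u₂, w₄, v₄, u₄} B'} (χ : DispCellMap F D D')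

/-- Preservation of cartesian 1-cells. -/
def PreservesCartesian : Prop :=
  ∀ {a b : B} {f : a ⟶ b} {x : D.Obj a} {y : D.Obj b} (ff : D.Hom f x y),
    Nonempty (DispBicat.CartesianStructure ff) →
      Nonempty (DispBicat.CartesianStructure (χ.map ff))

/-- Preservation of opcartesian 2-cells. -/
def PreservesOpcartesian₂ : Prop :=
  ∀ {a b : B} {f g : a ⟶ b} {θ : f ⟶ g} {x : D.Obj a} {y : D.Obj b}
    {ff : D.Hom f x y} {gg : D.Hom g x y} (θθ : D.Hom₂ θ ff gg),
    DispBicat.IsOpcartesian₂ θθ → DispBicat.IsOpcartesian₂ (χ.map₂ θθ)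

/-- Preservation of cartesian 2-cells. -/
def PreservesCartesian₂ : Prop :=
  ∀ {a b : B} {f g : a ⟶ b} {θ : f ⟶ g} {x : D.Obj a} {y : D.Obj b}
    {ff : D.Hom f x y} {gg : D.Hom g x y} (θθ : D.Hom₂ θ ff gg),
    DispBicat.IsCartesian₂ θθ → DispBicat.IsCartesian₂ (χ.map₂ θθ)

end DispCellMap

end DispPseudofunctors

/-! ### Comprehension bicategories -/

section Comprehension

variable {B : Type u} [Bicategory.{w, v} B] {D : DispBicat.{w, v, u, w', v', u'} B}

/-- The structure making `(B, D, χ)` a weak comprehension bicategory. -/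
structure WeakComprehensionBicat (χ : DispPseudofunctor (Pseudofunctor.id B) D (arrow B)) where
  globalCleaving : D.GlobalCleaving
  localOpcleaving : D.LocalOpcleaving
  whiskerLeft_opcartesian : ∀ {a b c : B} {f : a ⟶ b} {g h : b ⟶ c} {η : g ⟶ h}
    {x : D.Obj a} {y : D.Obj b} {z : D.Obj c} (ff : D.Hom f x y)
    {gg : D.Hom g y z} {hh : D.Hom h y z} (ηη : D.Hom₂ η gg hh),
    DispBicat.IsOpcartesian₂ ηη → DispBicat.IsOpcartesian₂ (D.whiskerLeft ff ηη)
  whiskerRight_opcartesian : ∀ {a b c : B} {f g : a ⟶ b} {h : b ⟶ c} {η : f ⟶ g}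
    {x : D.Obj a} {y : D.Obj b} {z : D.Obj c} {ff : D.Hom f x y} {gg : D.Hom g x y}
    (ηη : D.Hom₂ η ff gg) (hh : D.Hom h y z),
    DispBicat.IsOpcartesian₂ ηη → DispBicat.IsOpcartesian₂ (D.whiskerRight ηη hh)

/-- The structure making `(B, D, χ)` a comprehension bicategory. -/
structure ComprehensionBicat (χ : DispPseudofunctor (Pseudofunctor.id B) D (arrow B)) extends
    WeakComprehensionBicat χ where
  preservesCartesian : χ.PreservesCartesian
  preservesOpcartesian₂ : χ.PreservesOpcartesian₂

/-- The structure making `(B, D, χ)` a contravariant weak comprehension bicategory. -/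
structure ContravariantWeakComprehensionBicat
    (χ : DispPseudofunctor (Pseudofunctor.id B) D (arrow B)) where
  globalCleaving : D.GlobalCleaving
  localCleaving : D.LocalCleaving
  whiskerLeft_cartesian : ∀ {a b c : B} {f : a ⟶ b} {g h : b ⟶ c} {η : g ⟶ h}
    {x : D.Obj a} {y : D.Obj b} {z : D.Obj c} (ff : D.Hom f x y)
    {gg : D.Hom g y z} {hh : D.Hom h y z} (ηη : D.Hom₂ η gg hh),
    DispBicat.IsCartesian₂ ηη → DispBicat.IsCartesian₂ (D.whiskerLeft ff ηη)
  whiskerRight_cartesian : ∀ {a b c : B} {f g : a ⟶ b} {h : b ⟶ c} {η : f ⟶ g}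
    {x : D.Obj a} {y : D.Obj b} {z : D.Obj c} {ff : D.Hom f x y} {gg : D.Hom g x y}
    (ηη : D.Hom₂ η ff gg) (hh : D.Hom h y z),
    DispBicat.IsCartesian₂ ηη → DispBicat.IsCartesian₂ (D.whiskerRight ηη hh)

/-- The structure making `(B, D, χ)` a contravariant comprehension bicategory. -/
structure ContravariantComprehensionBicat
    (χ : DispPseudofunctor (Pseudofunctor.id B) D (arrow B)) extends
    ContravariantWeakComprehensionBicat χ where
  preservesCartesian : χ.PreservesCartesian
  preservesCartesian₂ : χ.PreservesCartesian₂

end Comprehension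

/-! ### Displayed categories -/

/-- A displayed category over a category `C`. -/
structure DispCat (C : Type u) [Category.{v} C] where
  Obj : C → Type u'
  Hom : ∀ {x y : C}, (x ⟶ y) → Obj x → Obj y → Type v'
  id : ∀ {x : C} (xx : Obj x), Hom (𝟙 x) xx xx
  comp : ∀ {x y z : C} {f : x ⟶ y} {g : y ⟶ z} {xx : Obj x} {yy : Obj y} {zz : Obj z},
    Hom f xx yy → Hom g yy zz → Hom (f ≫ g) xx zz
  id_comp : ∀ {x y : C} {f : x ⟶ y} {xx : Obj x} {yy : Obj y} (ff : Hom f xx yy),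
    comp (id xx) ff ≍ ff
  comp_id : ∀ {x y : C} {f : x ⟶ y} {xx : Obj x} {yy : Obj y} (ff : Hom f xx yy),
    comp ff (id yy) ≍ ff
  assoc : ∀ {x y z w : C} {f : x ⟶ y} {g : y ⟶ z} {h : z ⟶ w}
    {xx : Obj x} {yy : Obj y} {zz : Obj z} {ww : Obj w}
    (ff : Hom f xx yy) (gg : Hom g yy zz) (hh : Hom h zz ww),
    comp (comp ff gg) hh ≍ comp ff (comp gg hh)

namespace DispCat

variable {C : Type u} [Category.{v} C] (D : DispCat.{v, u, v', u'} C)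

theorem comp_heq {x y z : C} {f f' : x ⟶ y} {g g' : y ⟶ z} {xx : D.Obj x} {yy : D.Obj y}
    {zz : D.Obj z} {ff : D.Hom f xx yy} {ff' : D.Hom f' xx yy} {gg : D.Hom g yy zz}
    {gg' : D.Hom g' yy zz} (hf : f = f') (hg : g = g') (hff : ff ≍ ff') (hgg : gg ≍ gg') :
    D.comp ff gg ≍ D.comp ff' gg' := by
  subst hf hg
  cases hff
  cases hgg
  rfl

variable {D} in
/-- Opcartesian displayed morphisms. -/
def IsOpcartesian {x y : C} {f : x ⟶ y} {xx : D.Obj x} {yy : D.Obj y} (ff : D.Hom f xx yy) :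
    Prop :=
  ∀ {z : C} (g : y ⟶ z) {zz : D.Obj z} (hh : D.Hom (f ≫ g) xx zz),
    ∃! gg : D.Hom g yy zz, D.comp ff gg = hh

variable {D} in
/-- Cartesian displayed morphisms. -/
def IsCartesian {x y : C} {f : x ⟶ y} {xx : D.Obj x} {yy : D.Obj y} (ff : D.Hom f xx yy) :
    Prop :=
  ∀ {z : C} (g : z ⟶ x) {zz : D.Obj z} (hh : D.Hom (g ≫ f) zz yy),
    ∃! gg : D.Hom g zz xx, D.comp gg ff = hh

/-- An opcleaving: chosen opcartesian lifts of morphisms with given source. -/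
structure OpCleaving where
  obj : ∀ {x y : C} (_ : x ⟶ y) (_ : D.Obj x), D.Obj y
  hom : ∀ {x y : C} (f : x ⟶ y) (xx : D.Obj x), D.Hom f xx (obj f xx)
  opcartesian : ∀ {x y : C} (f : x ⟶ y) (xx : D.Obj x), IsOpcartesian (hom f xx)

/-- A cleaving: chosen cartesian lifts of morphisms with given target. -/
structure Cleaving where
  obj : ∀ {x y : C} (_ : x ⟶ y) (_ : D.Obj y), D.Obj x
  hom : ∀ {x y : C} (f : x ⟶ y) (yy : D.Obj y), D.Hom f (obj f yy) yy
  cartesian : ∀ {x y : C} (f : x ⟶ y) (yy : D.Obj y), IsCartesian (hom f yy)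

/-- Objects of the total category. -/
structure Total where
  base : C
  fiber : D.Obj base

/-- Morphisms of the total category. -/
@[ext]
structure TotalHom (X Y : D.Total) where
  base : X.base ⟶ Y.base
  fiber : D.Hom base X.fiber Y.fiber

/-- The total category of a displayed category. -/
instance totalCategory : Category.{max v v'} D.Total where
  Hom X Y := D.TotalHom X Y
  id X := ⟨𝟙 X.base, D.id X.fiber⟩
  comp f g := ⟨f.base ≫ g.base, D.comp f.fiber g.fiber⟩
  id_comp _ := TotalHom.ext (Category.id_comp _) (D.id_comp _)
  comp_id _ := TotalHom.ext (Category.comp_id _) (D.comp_id _)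
  assoc _ _ _ := TotalHom.ext (Category.assoc ..) (D.assoc ..)

/-- The projection of the total category. -/
def proj : D.Total ⥤ C where
  obj X := X.base
  map f := f.base

end DispCat

section DispFunctors

variable {C₁ : Type u₁} [Category.{v₁} C₁] {C₂ : Type u₂} [Category.{v₂} C₂]
  {C₃ : Type u₃} [Category.{v₃} C₃]

/-- Displayed functors over a functor. -/
structure DispFunctor (F : C₁ ⥤ C₂) (D₁ : DispCat.{v₁, u₁, v', u'} C₁)
    (D₂ : DispCat.{v₂, u₂, v', u'} C₂) where
  obj : ∀ {x : C₁}, D₁.Obj x → D₂.Obj (F.obj x)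
  map : ∀ {x y : C₁} {f : x ⟶ y} {xx : D₁.Obj x} {yy : D₁.Obj y},
    D₁.Hom f xx yy → D₂.Hom (F.map f) (obj xx) (obj yy)
  map_id : ∀ {x : C₁} (xx : D₁.Obj x), map (D₁.id xx) ≍ D₂.id (obj xx)
  map_comp : ∀ {x y z : C₁} {f : x ⟶ y} {g : y ⟶ z} {xx : D₁.Obj x} {yy : D₁.Obj y}
    {zz : D₁.Obj z} (ff : D₁.Hom f xx yy) (gg : D₁.Hom g yy zz),
    map (D₁.comp ff gg) ≍ D₂.comp (map ff) (map gg)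

namespace DispFunctor

theorem map_heq {F : C₁ ⥤ C₂} {D₁ : DispCat.{v₁, u₁, v', u'} C₁}
    {D₂ : DispCat.{v₂, u₂, v', u'} C₂} (FF : DispFunctor F D₁ D₂) {x y : C₁} {f f' : x ⟶ y}
    {xx : D₁.Obj x} {yy : D₁.Obj y} {ff : D₁.Hom f xx yy} {ff' : D₁.Hom f' xx yy}
    (hf : f = f') (hff : ff ≍ ff') : FF.map ff ≍ FF.map ff' := by
  subst hf
  cases hff
  rfl

/-- The identity displayed functor. -/
def id (D : DispCat.{v₁, u₁, v', u'} C₁) : DispFunctor (𝟭 C₁) D D where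
  obj xx := xx
  map ff := ff
  map_id _ := HEq.rfl
  map_comp _ _ := HEq.rfl

/-- Composition of displayed functors. -/
def comp {F : C₁ ⥤ C₂} {G : C₂ ⥤ C₃} {D₁ : DispCat.{v₁, u₁, v', u'} C₁}
    {D₂ : DispCat.{v₂, u₂, v', u'} C₂} {D₃ : DispCat.{v₃, u₃, v', u'} C₃}
    (FF : DispFunctor F D₁ D₂) (GG : DispFunctor G D₂ D₃) : DispFunctor (F ⋙ G) D₁ D₃ where
  obj xx := GG.obj (FF.obj xx)
  map ff := GG.map (FF.map ff)
  map_id xx := (GG.map_heq (F.map_id _) (FF.map_id xx)).trans (GG.map_id _)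
  map_comp ff gg := (GG.map_heq (F.map_comp _ _) (FF.map_comp ff gg)).trans (GG.map_comp _ _)

/-- The functor between total categories induced by a displayed functor. -/
def total {F : C₁ ⥤ C₂} {D₁ : DispCat.{v₁, u₁, v', u'} C₁} {D₂ : DispCat.{v₂, u₂, v', u'} C₂}
    (FF : DispFunctor F D₁ D₂) : D₁.Total ⥤ D₂.Total where
  obj X := ⟨F.obj X.base, FF.obj X.fiber⟩
  map f := ⟨F.map f.base, FF.map f.fiber⟩
  map_id _ := DispCat.TotalHom.ext (F.map_id _) (FF.map_id _)
  map_comp _ _ := DispCat.TotalHom.ext (F.map_comp _ _) (FF.map_comp _ _)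

/-- The square formed by the total functor and the projections, which commutes strictly. -/
def totalIso {F : C₁ ⥤ C₂} {D₁ : DispCat.{v₁, u₁, v', u'} C₁}
    {D₂ : DispCat.{v₂, u₂, v', u'} C₂} (FF : DispFunctor F D₁ D₂) :
    D₁.proj ⋙ F ≅ FF.total ⋙ D₂.proj :=
  Iso.refl (D₁.proj ⋙ F)

end DispFunctor

/-- Displayed natural transformations over a natural transformation. -/
@[ext]
structure DispNatTrans {F G : C₁ ⥤ C₂} (α : F ⟶ G) {D₁ : DispCat.{v₁, u₁, v', u'} C₁}
    {D₂ : DispCat.{v₂, u₂, v', u'} C₂} (FF : DispFunctor F D₁ D₂) (GG : DispFunctor G D₁ D₂) where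
  app : ∀ {x : C₁} (xx : D₁.Obj x), D₂.Hom (α.app x) (FF.obj xx) (GG.obj xx)
  naturality : ∀ {x y : C₁} {f : x ⟶ y} {xx : D₁.Obj x} {yy : D₁.Obj y} (ff : D₁.Hom f xx yy),
    D₂.comp (FF.map ff) (app yy) ≍ D₂.comp (app xx) (GG.map ff)

namespace DispNatTrans

variable {D₁ : DispCat.{v₁, u₁, v', u'} C₁} {D₂ : DispCat.{v₂, u₂, v', u'} C₂}
  {D₃ : DispCat.{v₃, u₃, v', u'} C₃}

theorem hext {F G : C₁ ⥤ C₂} {α β : F ⟶ G} {FF : DispFunctor F D₁ D₂} {GG : DispFunctor G D₁ D₂}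
    {αα : DispNatTrans α FF GG} {ββ : DispNatTrans β FF GG} (h : α = β)
    (happ : ∀ (x : C₁) (xx : D₁.Obj x), αα.app xx ≍ ββ.app xx) : αα ≍ ββ := by
  subst h
  apply heq_of_eq
  ext x xx
  exact eq_of_heq (happ x xx)

/-- The identity displayed natural transformation. -/
def id {F : C₁ ⥤ C₂} (FF : DispFunctor F D₁ D₂) : DispNatTrans (𝟙 F) FF FF where
  app xx := D₂.id (FF.obj xx)
  naturality _ := (D₂.comp_id _).trans (D₂.id_comp _).symm

/-- Vertical composition. -/
def comp {F G H : C₁ ⥤ C₂} {α : F ⟶ G} {β : G ⟶ H} {FF : DispFunctor F D₁ D₂}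
    {GG : DispFunctor G D₁ D₂} {HH : DispFunctor H D₁ D₂} (αα : DispNatTrans α FF GG)
    (ββ : DispNatTrans β GG HH) : DispNatTrans (α ≫ β) FF HH where
  app xx := D₂.comp (αα.app xx) (ββ.app xx)
  naturality ff :=
    (D₂.assoc _ _ _).symm.trans <|
      (D₂.comp_heq (α.naturality _) rfl (αα.naturality ff) HEq.rfl).trans <|
        (D₂.assoc _ _ _).trans <|
          (D₂.comp_heq rfl (β.naturality _) HEq.rfl (ββ.naturality ff)).trans
            (D₂.assoc _ _ _).symm

/-- Left whiskering. -/
def whiskerLeft {F : C₁ ⥤ C₂} {G H : C₂ ⥤ C₃} {α : G ⟶ H} (FF : DispFunctor F D₁ D₂)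
    {GG : DispFunctor G D₂ D₃} {HH : DispFunctor H D₂ D₃} (αα : DispNatTrans α GG HH) :
    DispNatTrans (Functor.whiskerLeft F α) (FF.comp GG) (FF.comp HH) where
  app xx := αα.app (FF.obj xx)
  naturality ff := αα.naturality (FF.map ff)

/-- Right whiskering. -/
def whiskerRight {F G : C₁ ⥤ C₂} {H : C₂ ⥤ C₃} {α : F ⟶ G} {FF : DispFunctor F D₁ D₂}
    {GG : DispFunctor G D₁ D₂} (αα : DispNatTrans α FF GG) (HH : DispFunctor H D₂ D₃) :
    DispNatTrans (Functor.whiskerRight α H) (FF.comp HH) (GG.comp HH) where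
  app xx := HH.map (αα.app xx)
  naturality ff :=
    (HH.map_comp _ _).symm.trans <|
      (HH.map_heq (α.naturality _) (αα.naturality ff)).trans (HH.map_comp _ _)

/-- The natural transformation between total functors induced by a displayed natural
transformation. -/
def total {F G : C₁ ⥤ C₂} {α : F ⟶ G} {FF : DispFunctor F D₁ D₂} {GG : DispFunctor G D₁ D₂}
    (αα : DispNatTrans α FF GG) : FF.total ⟶ GG.total where
  app X := ⟨α.app X.base, αα.app X.fiber⟩
  naturality _ _ _ := DispCat.TotalHom.ext (α.naturality _) (αα.naturality _)

end DispNatTrans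

end DispFunctors

/-! ### The displayed bicategories of displayed categories, of opcleavings and of cleavings -/

/-- The data of the displayed bicategory of displayed categories. -/
def dispCatCore : DispBicatCore.{max v u, max v u, max (v + 1) (u + 1), max v u, max v u,
    max (v + 1) (u + 1)} Cat.{v, u} where
  Obj C := DispCat.{v, u, v, u} C
  Hom F D₁ D₂ := DispFunctor F.toFunctor D₁ D₂
  Hom₂ α _ _ FF GG := DispNatTrans α.toNatTrans FF GG
  id D := DispFunctor.id D
  comp FF GG := FF.comp GG
  id₂ FF := DispNatTrans.id FF
  comp₂ αα ββ := αα.comp ββ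
  whiskerLeft FF _ _ αα := DispNatTrans.whiskerLeft FF αα
  whiskerRight αα HH := DispNatTrans.whiskerRight αα HH

theorem dispCat_hext {C₁ C₂ : Cat.{v, u}} {F G : C₁ ⟶ C₂} {α β : F ⟶ G}
    {D₁ : DispCat.{v, u, v, u} C₁} {D₂ : DispCat.{v, u, v, u} C₂}
    {FF : DispFunctor F.toFunctor D₁ D₂} {GG : DispFunctor G.toFunctor D₁ D₂}
    {αα : DispNatTrans α.toNatTrans FF GG} {ββ : DispNatTrans β.toNatTrans FF GG} (h : α = β)
    (happ : ∀ (x : C₁) (xx : D₁.Obj x), αα.app xx ≍ ββ.app xx) : αα ≍ ββ :=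
  DispNatTrans.hext (congrArg Cat.Hom₂.toNatTrans h) happ

theorem DispCat.id_comp_comp_id {C : Type u} [Category.{v} C] (D : DispCat.{v, u, v', u'} C)
    {x y : C} {f : x ⟶ y} {xx : D.Obj x} {yy : D.Obj y} (ff : D.Hom f xx yy) :
    D.comp (D.id xx) (D.comp ff (D.id yy)) ≍ ff :=
  (D.id_comp _).trans (D.comp_id _)

/-- The displayed bicategory over `Cat` of displayed categories, displayed functors and displayed
natural transformations. Associators and unitors are identities in each component. -/
def dispCatBicat : DispBicat.{max v u, max v u, max (v + 1) (u + 1), max v u, max v u,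
    max (v + 1) (u + 1)} Cat.{v, u} where
  toDispBicatCore := dispCatCore
  associator {_ _ _ _ _ _ _ _ _ _ D} FF GG HH :=
    { hom :=
        { app xx := D.id (HH.obj (GG.obj (FF.obj xx)))
          naturality _ := (D.comp_id _).trans (D.id_comp _).symm }
      inv :=
        { app xx := D.id (HH.obj (GG.obj (FF.obj xx)))
          naturality _ := (D.comp_id _).trans (D.id_comp _).symm }
      hom_inv_id := dispCat_hext (Iso.hom_inv_id _) fun _ _ => D.id_comp _
      inv_hom_id := dispCat_hext (Iso.inv_hom_id _) fun _ _ => D.id_comp _ }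
  leftUnitor {_ _ _ _ D} FF :=
    { hom :=
        { app xx := D.id (FF.obj xx)
          naturality _ := (D.comp_id _).trans (D.id_comp _).symm }
      inv :=
        { app xx := D.id (FF.obj xx)
          naturality _ := (D.comp_id _).trans (D.id_comp _).symm }
      hom_inv_id := dispCat_hext (Iso.hom_inv_id _) fun _ _ => D.id_comp _
      inv_hom_id := dispCat_hext (Iso.inv_hom_id _) fun _ _ => D.id_comp _ }
  rightUnitor {_ _ _ _ D} FF :=
    { hom :=
        { app xx := D.id (FF.obj xx)
          naturality _ := (D.comp_id _).trans (D.id_comp _).symm }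
      inv :=
        { app xx := D.id (FF.obj xx)
          naturality _ := (D.comp_id _).trans (D.id_comp _).symm }
      hom_inv_id := dispCat_hext (Iso.hom_inv_id _) fun _ _ => D.id_comp _
      inv_hom_id := dispCat_hext (Iso.inv_hom_id _) fun _ _ => D.id_comp _ }
  id_comp₂ _ := dispCat_hext (Category.id_comp _) fun _ _ => DispCat.id_comp _ _
  comp_id₂ _ := dispCat_hext (Category.comp_id _) fun _ _ => DispCat.comp_id _ _
  assoc₂ _ _ _ := dispCat_hext (Category.assoc ..) fun _ _ => DispCat.assoc _ _ _ _
  whiskerLeft_id _ _ := dispCat_hext (whiskerLeft_id ..) fun _ _ => HEq.rfl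
  whiskerLeft_comp _ _ _ _ _ _ := dispCat_hext (whiskerLeft_comp ..) fun _ _ => HEq.rfl
  id_whiskerLeft _ := dispCat_hext (id_whiskerLeft ..) fun _ _ =>
    (DispCat.id_comp_comp_id _ _).symm
  comp_whiskerLeft _ _ _ _ _ := dispCat_hext (comp_whiskerLeft ..) fun _ _ =>
    (DispCat.id_comp_comp_id _ _).symm
  id_whiskerRight _ gg := dispCat_hext (id_whiskerRight ..) fun _ _ => DispFunctor.map_id gg _
  comp_whiskerRight _ _ ii := dispCat_hext (comp_whiskerRight ..) fun _ _ =>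
    DispFunctor.map_comp ii _ _
  whiskerRight_id _ := dispCat_hext (whiskerRight_id ..) fun _ _ =>
    (DispCat.id_comp_comp_id _ _).symm
  whiskerRight_comp _ _ _ := dispCat_hext (whiskerRight_comp ..) fun _ _ =>
    (DispCat.id_comp_comp_id _ _).symm
  whisker_assoc _ _ _ _ _ := dispCat_hext (whisker_assoc ..) fun _ _ =>
    (DispCat.id_comp_comp_id _ _).symm
  whisker_exchange ηη θθ := dispCat_hext (whisker_exchange ..) fun _ _ =>
    (DispNatTrans.naturality θθ (DispNatTrans.app ηη _)).symm
  pentagon {_ _ _ _ _ _ _ _ i _ _ _ _ _} _ _ _ ii := dispCat_hext (pentagon ..) fun _ _ =>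
    (DispCat.comp_heq _ (i.toFunctor.map_id _) rfl (DispFunctor.map_id ii _) HEq.rfl).trans
      (DispCat.id_comp _ _)
  triangle _ gg := dispCat_hext (triangle ..) fun _ _ =>
    (DispCat.id_comp _ _).trans (DispFunctor.map_id gg _).symm

/-- The displayed bicategory `OpCleav` over `Cat`: displayed categories with an opcleaving,
displayed functors preserving opcartesian morphisms, displayed natural transformations. -/
def OpCleav : DispBicat.{max v u, max v u, max (v + 1) (u + 1), max v u, max v u,
    max (v + 1) (u + 1)} Cat.{v, u} :=
  dispCatBicat.{v, u}.restrict (fun {_} D => DispCat.OpCleaving D)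
    (fun {_ _ _ D₁ _} FF => ∀ {x y} {f : x ⟶ y} {xx : DispCat.Obj D₁ x} {yy : DispCat.Obj D₁ y}
      (ff : DispCat.Hom D₁ f xx yy),
      DispCat.IsOpcartesian ff → DispCat.IsOpcartesian (DispFunctor.map FF ff))
    (fun _ _ _ _ _ _ _ h => h) (fun _ _ hF hG _ _ _ _ _ _ h => hG _ (hF _ h))

/-- The displayed bicategory `Cleav` over `Cat`: displayed categories with a cleaving, displayed
functors preserving cartesian morphisms, displayed natural transformations. -/
def Cleav : DispBicat.{max v u, max v u, max (v + 1) (u + 1), max v u, max v u,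
    max (v + 1) (u + 1)} Cat.{v, u} :=
  dispCatBicat.{v, u}.restrict (fun {_} D => DispCat.Cleaving D)
    (fun {_ _ _ D₁ _} FF => ∀ {x y} {f : x ⟶ y} {xx : DispCat.Obj D₁ x} {yy : DispCat.Obj D₁ y}
      (ff : DispCat.Hom D₁ f xx yy),
      DispCat.IsCartesian ff → DispCat.IsCartesian (DispFunctor.map FF ff))
    (fun _ _ _ _ _ _ _ h => h) (fun _ _ hF hG _ _ _ _ _ _ h => hG _ (hF _ h))

/-! ### Comprehension by total categories -/

/-- The total category of a displayed category, as an object of `Cat`. -/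
abbrev totalCat {C : Cat.{v, u}} (D : DispCat.{v, u, v, u} C) : Cat.{v, u} :=
  @Cat.of D.Total (DispCat.totalCategory.{v, u, v, u} D)

/-- The projection of the total category, as an arrow of `Cat`. -/
def projArrow {C : Cat.{v, u}} (D : DispCat.{v, u, v, u} C) : ArrowObj C where
  dom := totalCat D
  arr := ⟨D.proj⟩

/-- The square of a displayed functor `FF` over `F`, formed by the total functor of `FF`, the
projections and `F`; it commutes strictly. -/
def totalSquare {C₁ C₂ : Cat.{v, u}} {F : C₁ ⟶ C₂} {D₁ : DispCat.{v, u, v, u} C₁}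
    {D₂ : DispCat.{v, u, v, u} C₂} (FF : DispFunctor F.toFunctor D₁ D₂) :
    ArrowHom F (projArrow D₁) (projArrow D₂) where
  top := ⟨FF.total⟩
  iso :=
    { hom := ⟨FF.totalIso.hom⟩
      inv := ⟨FF.totalIso.inv⟩
      hom_inv_id := Cat.Hom₂.ext FF.totalIso.hom_inv_id
      inv_hom_id := Cat.Hom₂.ext FF.totalIso.inv_hom_id }

/-- The total natural transformation of a displayed natural transformation, as a 2-cell of
squares. -/
def totalSquare₂ {C₁ C₂ : Cat.{v, u}} {F G : C₁ ⟶ C₂} {α : F ⟶ G} {D₁ : DispCat.{v, u, v, u} C₁}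
    {D₂ : DispCat.{v, u, v, u} C₂} {FF : DispFunctor F.toFunctor D₁ D₂}
    {GG : DispFunctor G.toFunctor D₁ D₂} (αα : DispNatTrans α.toNatTrans FF GG) :
    ArrowHom₂ α (totalSquare FF) (totalSquare GG) where
  top := ⟨αα.total⟩
  comm := by
    apply Cat.Hom₂.ext
    ext X
    exact (Category.id_comp (α.toNatTrans.app X.base)).trans (Category.comp_id _).symm

/-- The cell map sending a displayed category `D` over `C` to the projection from its total
category to `C`, a displayed functor to the strictly commuting square formed by its total functor,
and a displayed natural transformation to its total natural transformation. -/
def totalCellMap : DispCellMap (Pseudofunctor.id Cat.{v, u}) dispCatBicat.{v, u}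
    (arrow Cat.{v, u}) where
  obj {_} D := projArrow D
  map FF := totalSquare FF
  map₂ αα := totalSquare₂ αα

/-- The restriction of the total category construction to opcleavings. -/
def opCleavCellMap : DispCellMap (Pseudofunctor.id Cat.{v, u}) OpCleav.{v, u}
    (arrow Cat.{v, u}) where
  obj D := totalCellMap.obj D.1
  map FF := totalCellMap.map FF.1
  map₂ αα := totalCellMap.map₂ αα

/-- The restriction of the total category construction to cleavings. -/
def cleavCellMap : DispCellMap (Pseudofunctor.id Cat.{v, u}) Cleav.{v, u}
    (arrow Cat.{v, u}) where
  obj D := totalCellMap.obj D.1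
  map FF := totalCellMap.map FF.1
  map₂ αα := totalCellMap.map₂ αα

end CompBicat

/-! Two devices reduce the theorem to elementary facts about displayed categories. First, equations
between displayed cells over equal base cells become honest equations in the total category. There,
opcartesian morphisms compose, cancel on the left and are unique up to isomorphism. Second, the
displayed 1-cells and 2-cells between two fixed objects of a displayed bicategory form a displayed
category (`homDispCat`), so the same facts apply to opcartesian 2-cells.

Global cleaving: the cartesian lift of `D` along `F` is the pullback of `D`. A displayed 1-cell is
cartesian as soon as lifts exist and whiskering with it is bijective on 2-cells
(`CartesianStructure.ofBijective`); for the projection of a pullback the lifts are strict.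

Local opcleaving: a natural transformation is lifted pointwise, by pushing each object of the image
forward. Any opcartesian 2-cell of `OpCleav` differs from this lift by an invertible 2-cell, hence
is itself pointwise opcartesian (`isOpcartesian_app_of_isOpcartesian₂`). Stability under left
whiskering is then immediate, and stability under right whiskering holds because the 1-cells
preserve opcartesian morphisms.

Preservation by `χ`: for 2-cells, a pointwise opcartesian transformation keeps its universal
property against arbitrary functors into the total category. For 1-cells, testing a cartesian
displayed functor against the point shows that it is fully faithful, and essentially surjective over
identities. Since an opcleaving lifts isomorphisms, these two properties give the bicategorical
pullback property of the square of total categories, which is a cartesian structure in the displayed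
bicategory of arrows (`totalSquare_cartesianStructure`).

The contravariant half is dual on displayed morphisms and 2-cells; the argument for cartesian
1-cells is shared. -/

namespace CompBicat

namespace DispCat

/-! ### Opcartesian and cartesian morphisms in the total category -/

section Total

variable {C : Type u} [Category.{v} C] {D : DispCat.{v, u, v', u'} C}

/-- A displayed morphism as a morphism of the total category. -/
def homMk {x y : C} {f : x ⟶ y} {xx : D.Obj x} {yy : D.Obj y} (ff : D.Hom f xx yy) :
    (⟨x, xx⟩ : D.Total) ⟶ ⟨y, yy⟩ := ⟨f, ff⟩

/-- With its converse `fiber_heq`, this trades heterogeneous equalities of displayed morphisms for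
equalities in an ordinary category, where associativity can be rewritten freely. -/
theorem total_ext {X Y : D.Total} {φ ψ : X ⟶ Y} (h : φ.base = ψ.base)
    (h' : φ.fiber ≍ ψ.fiber) : φ = ψ :=
  TotalHom.ext h h'

theorem fiber_heq {X Y : D.Total} {φ ψ : X ⟶ Y} (h : φ = ψ) : φ.fiber ≍ ψ.fiber := by
  rw [h]

/-- Transport of a displayed morphism along an equality of morphisms of the base. -/
def castHom {x y : C} {f g : x ⟶ y} (h : f = g) {xx : D.Obj x} {yy : D.Obj y}
    (ff : D.Hom f xx yy) : D.Hom g xx yy :=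
  h ▸ ff

theorem castHom_heq {x y : C} {f g : x ⟶ y} (h : f = g) {xx : D.Obj x} {yy : D.Obj y}
    (ff : D.Hom f xx yy) : castHom h ff ≍ ff := by
  subst h
  rfl

theorem total_base_hom_inv {X Y : D.Total} (e : X ≅ Y) : e.hom.base ≫ e.inv.base = 𝟙 X.base :=
  congrArg TotalHom.base e.hom_inv_id

theorem total_base_inv_hom {X Y : D.Total} (e : X ≅ Y) : e.inv.base ≫ e.hom.base = 𝟙 Y.base :=
  congrArg TotalHom.base e.inv_hom_id

theorem IsOpcartesian.of_total_eq {X Y : D.Total} {φ ψ : X ⟶ Y} (h : IsOpcartesian φ.fiber)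
    (e : φ = ψ) : IsOpcartesian ψ.fiber :=
  e ▸ h

theorem IsCartesian.of_total_eq {X Y : D.Total} {φ ψ : X ⟶ Y} (h : IsCartesian φ.fiber)
    (e : φ = ψ) : IsCartesian ψ.fiber :=
  e ▸ h

/-- The definition requires the morphism to be factored to lie literally over a composite. Making
the base equation a hypothesis removes every transport from later uses. -/
theorem IsOpcartesian.existsUnique_total {X Y : D.Total} {φ : X ⟶ Y}
    (h : IsOpcartesian φ.fiber) {Z : D.Total} (k : X ⟶ Z) (g : Y.base ⟶ Z.base)
    (w : φ.base ≫ g = k.base) : ∃! l : Y ⟶ Z, l.base = g ∧ φ ≫ l = k := by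
  obtain ⟨z, zz⟩ := Z
  obtain ⟨kb, kf⟩ := k
  subst w
  obtain ⟨gg, hgg, huniq⟩ := h g kf
  refine ⟨⟨g, gg⟩, ⟨rfl, total_ext rfl (heq_of_eq hgg)⟩, ?_⟩
  rintro ⟨_, l⟩ ⟨rfl, hl⟩
  exact total_ext rfl (heq_of_eq (huniq l (eq_of_heq (fiber_heq hl))))

theorem isOpcartesian_of_total {X Y : D.Total} {φ : X ⟶ Y}
    (h : ∀ {Z : D.Total} (k : X ⟶ Z) (g : Y.base ⟶ Z.base), φ.base ≫ g = k.base →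
      ∃! l : Y ⟶ Z, l.base = g ∧ φ ≫ l = k) : IsOpcartesian φ.fiber := by
  intro z g zz hh
  obtain ⟨⟨_, l⟩, ⟨rfl, hl⟩, huniq⟩ := h (Z := ⟨z, zz⟩) ⟨φ.base ≫ g, hh⟩ g rfl
  refine ⟨l, eq_of_heq (fiber_heq hl), fun l' hl' => ?_⟩
  exact eq_of_heq (fiber_heq (huniq ⟨_, l'⟩ ⟨rfl, total_ext rfl (heq_of_eq hl')⟩))

theorem IsOpcartesian.total_hom_ext {X Y Z : D.Total} {φ : X ⟶ Y} (h : IsOpcartesian φ.fiber)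
    {l l' : Y ⟶ Z} (hb : l.base = l'.base) (hl : φ ≫ l = φ ≫ l') : l = l' :=
  (h.existsUnique_total (φ ≫ l') l'.base rfl).unique ⟨hb, hl⟩ ⟨rfl, rfl⟩

/-- Factor through `φ` over `ψ.base ≫ g`, then factor the result through `ψ` over `g`. -/
theorem IsOpcartesian.total_comp {X Y Z : D.Total} {φ : X ⟶ Y} {ψ : Y ⟶ Z}
    (h : IsOpcartesian φ.fiber) (h' : IsOpcartesian ψ.fiber) : IsOpcartesian (φ ≫ ψ).fiber := by
  refine isOpcartesian_of_total fun {W} k g w => ?_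
  have w' : φ.base ≫ ψ.base ≫ g = k.base := (Category.assoc ..).symm.trans w
  obtain ⟨l, ⟨hl, hl'⟩, hu⟩ := h.existsUnique_total k (ψ.base ≫ g) w'
  obtain ⟨m, ⟨hm, hm'⟩, hu'⟩ := h'.existsUnique_total l g hl.symm
  refine ⟨m, ⟨hm, by rw [Category.assoc, hm', hl']⟩, fun n ⟨hn, hn'⟩ => hu' n ⟨hn, hu _ ⟨?_, ?_⟩⟩⟩
  · exact congrArg (ψ.base ≫ ·) hn
  · rw [← hn', Category.assoc]

/-- The factorization of `φ ≫ k` through `φ ≫ ψ` also factors `k` through `ψ`, because morphisms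
over the same base out of the target of `φ` are detected by precomposition with `φ`. -/
theorem IsOpcartesian.of_total_comp {X Y Z : D.Total} {φ : X ⟶ Y} {ψ : Y ⟶ Z}
    (h : IsOpcartesian φ.fiber) (h' : IsOpcartesian (φ ≫ ψ).fiber) : IsOpcartesian ψ.fiber := by
  refine isOpcartesian_of_total fun {W} k g w => ?_
  obtain ⟨m, ⟨hm, hm'⟩, hu'⟩ := h'.existsUnique_total (φ ≫ k) g
    ((Category.assoc ..).trans (congrArg (φ.base ≫ ·) w))
  refine ⟨m, ⟨hm, h.total_hom_ext ?_ ?_⟩, fun n ⟨hn, hn'⟩ => hu' n ⟨hn, ?_⟩⟩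
  · exact (congrArg (ψ.base ≫ ·) hm).trans w
  · rw [← hm', Category.assoc]
  · rw [Category.assoc, hn']

theorem isOpcartesian_total_iso {X Y : D.Total} (e : X ≅ Y) : IsOpcartesian e.hom.fiber := by
  refine isOpcartesian_of_total fun {W} k g w => ?_
  refine ⟨e.inv ≫ k, ⟨?_, by simp⟩, fun n ⟨_, hn⟩ => by simp [← hn]⟩
  change e.inv.base ≫ k.base = g
  rw [← w, ← Category.assoc, total_base_inv_hom, Category.id_comp]

/-- The inverse is the factorization of the identity over the inverse of the base; it is two-sided
by cancellation of `φ`. -/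
theorem IsOpcartesian.isIso_total {X Y : D.Total} {φ : X ⟶ Y} (h : IsOpcartesian φ.fiber)
    [IsIso φ.base] : IsIso φ := by
  obtain ⟨l, ⟨hl, hl'⟩, -⟩ := h.existsUnique_total (𝟙 X) (inv φ.base) (IsIso.hom_inv_id _)
  refine ⟨l, hl', h.total_hom_ext ?_ ?_⟩
  · exact (congrArg (· ≫ φ.base) hl).trans (IsIso.inv_hom_id _)
  · rw [← Category.assoc, hl', Category.id_comp, Category.comp_id]

/-- Two opcartesian morphisms over the same morphism differ by an isomorphism. -/
theorem IsOpcartesian.exists_iso {X Y Y' : D.Total} {φ : X ⟶ Y} {ψ : X ⟶ Y'}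
    (h : IsOpcartesian φ.fiber) (h' : IsOpcartesian ψ.fiber) (g : Y.base ≅ Y'.base)
    (w : φ.base ≫ g.hom = ψ.base) : ∃ e : Y ≅ Y', φ ≫ e.hom = ψ := by
  obtain ⟨l, ⟨hl, hl'⟩, -⟩ := h.existsUnique_total ψ g.hom w
  -- The comparison morphism is opcartesian by cancellation and lies over an isomorphism, so it is
  -- invertible.
  have hi : IsOpcartesian l.fiber := h.of_total_comp (hl' ▸ h')
  have : IsIso l.base := hl ▸ inferInstance
  have : IsIso l := hi.isIso_total
  exact ⟨asIso l, hl'⟩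

theorem IsOpcartesian.existsUnique_heq {x y z : C} {f : x ⟶ y} {xx : D.Obj x} {yy : D.Obj y}
    {ff : D.Hom f xx yy} (h : IsOpcartesian ff) (g : y ⟶ z) {k : x ⟶ z} (w : f ≫ g = k)
    {zz : D.Obj z} (kk : D.Hom k xx zz) : ∃! gg : D.Hom g yy zz, D.comp ff gg ≍ kk := by
  subst w
  simpa only [heq_iff_eq] using h g kk

/-- The cartesian versions, up to `IsCartesian.existsUnique_heq`, reverse the direction of
composition in the arguments above. -/
theorem IsCartesian.existsUnique_total {X Y : D.Total} {φ : X ⟶ Y}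
    (h : IsCartesian φ.fiber) {Z : D.Total} (k : Z ⟶ Y) (g : Z.base ⟶ X.base)
    (w : g ≫ φ.base = k.base) : ∃! l : Z ⟶ X, l.base = g ∧ l ≫ φ = k := by
  obtain ⟨z, zz⟩ := Z
  obtain ⟨kb, kf⟩ := k
  subst w
  obtain ⟨gg, hgg, huniq⟩ := h g kf
  refine ⟨⟨g, gg⟩, ⟨rfl, total_ext rfl (heq_of_eq hgg)⟩, ?_⟩
  rintro ⟨_, l⟩ ⟨rfl, hl⟩
  exact total_ext rfl (heq_of_eq (huniq l (eq_of_heq (fiber_heq hl))))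

theorem isCartesian_of_total {X Y : D.Total} {φ : X ⟶ Y}
    (h : ∀ {Z : D.Total} (k : Z ⟶ Y) (g : Z.base ⟶ X.base), g ≫ φ.base = k.base →
      ∃! l : Z ⟶ X, l.base = g ∧ l ≫ φ = k) : IsCartesian φ.fiber := by
  intro z g zz hh
  obtain ⟨⟨_, l⟩, ⟨rfl, hl⟩, huniq⟩ := h (Z := ⟨z, zz⟩) ⟨g ≫ φ.base, hh⟩ g rfl
  refine ⟨l, eq_of_heq (fiber_heq hl), fun l' hl' => ?_⟩
  exact eq_of_heq (fiber_heq (huniq ⟨_, l'⟩ ⟨rfl, total_ext rfl (heq_of_eq hl')⟩))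

theorem IsCartesian.total_hom_ext {X Y Z : D.Total} {φ : X ⟶ Y} (h : IsCartesian φ.fiber)
    {l l' : Z ⟶ X} (hb : l.base = l'.base) (hl : l ≫ φ = l' ≫ φ) : l = l' :=
  (h.existsUnique_total (l' ≫ φ) l'.base rfl).unique ⟨hb, hl⟩ ⟨rfl, rfl⟩

theorem IsCartesian.total_comp {X Y Z : D.Total} {φ : X ⟶ Y} {ψ : Y ⟶ Z}
    (h : IsCartesian φ.fiber) (h' : IsCartesian ψ.fiber) : IsCartesian (φ ≫ ψ).fiber := by
  refine isCartesian_of_total fun {W} k g w => ?_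
  have w' : (g ≫ φ.base) ≫ ψ.base = k.base := (Category.assoc ..).trans w
  obtain ⟨l, ⟨hl, hl'⟩, hu⟩ := h'.existsUnique_total k (g ≫ φ.base) w'
  obtain ⟨m, ⟨hm, hm'⟩, hu'⟩ := h.existsUnique_total l g hl.symm
  refine ⟨m, ⟨hm, by rw [← Category.assoc, hm', hl']⟩,
    fun n ⟨hn, hn'⟩ => hu' n ⟨hn, hu _ ⟨?_, ?_⟩⟩⟩
  · exact congrArg (· ≫ φ.base) hn
  · rw [← hn', Category.assoc]

theorem IsCartesian.of_total_comp {X Y Z : D.Total} {φ : X ⟶ Y} {ψ : Y ⟶ Z}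
    (h : IsCartesian ψ.fiber) (h' : IsCartesian (φ ≫ ψ).fiber) : IsCartesian φ.fiber := by
  refine isCartesian_of_total fun {W} k g w => ?_
  obtain ⟨m, ⟨hm, hm'⟩, hu'⟩ := h'.existsUnique_total (k ≫ ψ) g
    ((Category.assoc ..).symm.trans (congrArg (· ≫ ψ.base) w))
  refine ⟨m, ⟨hm, h.total_hom_ext ?_ ?_⟩, fun n ⟨hn, hn'⟩ => hu' n ⟨hn, ?_⟩⟩
  · exact (congrArg (· ≫ φ.base) hm).trans w
  · rw [← hm', Category.assoc]
  · rw [← Category.assoc, hn']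

theorem isCartesian_total_iso {X Y : D.Total} (e : X ≅ Y) : IsCartesian e.hom.fiber := by
  refine isCartesian_of_total fun {W} k g w => ?_
  refine ⟨k ≫ e.inv, ⟨?_, by simp⟩, fun n ⟨_, hn⟩ => by simp [← hn]⟩
  change k.base ≫ e.inv.base = g
  rw [← w, Category.assoc, total_base_hom_inv, Category.comp_id]

theorem IsCartesian.isIso_total {X Y : D.Total} {φ : X ⟶ Y} (h : IsCartesian φ.fiber)
    [IsIso φ.base] : IsIso φ := by
  obtain ⟨l, ⟨hl, hl'⟩, -⟩ := h.existsUnique_total (𝟙 Y) (inv φ.base) (IsIso.inv_hom_id _)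
  refine ⟨l, h.total_hom_ext ?_ ?_, hl'⟩
  · exact (congrArg (φ.base ≫ ·) hl).trans (IsIso.hom_inv_id _)
  · rw [Category.assoc, hl', Category.id_comp, Category.comp_id]

/-- Two cartesian morphisms over the same morphism differ by an isomorphism. -/
theorem IsCartesian.exists_iso {X X' Y : D.Total} {φ : X ⟶ Y} {ψ : X' ⟶ Y}
    (h : IsCartesian φ.fiber) (h' : IsCartesian ψ.fiber) (g : X'.base ≅ X.base)
    (w : g.hom ≫ φ.base = ψ.base) : ∃ e : X' ≅ X, e.hom ≫ φ = ψ := by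
  obtain ⟨l, ⟨hl, hl'⟩, -⟩ := h.existsUnique_total ψ g.hom w
  have hi : IsCartesian l.fiber := h.of_total_comp (hl' ▸ h')
  have : IsIso l.base := hl ▸ inferInstance
  have : IsIso l := hi.isIso_total
  exact ⟨asIso l, hl'⟩

theorem IsCartesian.existsUnique_heq {x y z : C} {f : x ⟶ y} {xx : D.Obj x} {yy : D.Obj y}
    {ff : D.Hom f xx yy} (h : IsCartesian ff) (g : z ⟶ x) {k : z ⟶ y} (w : g ≫ f = k)
    {zz : D.Obj z} (kk : D.Hom k zz yy) : ∃! gg : D.Hom g zz xx, D.comp gg ff ≍ kk := by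
  subst w
  simpa only [heq_iff_eq] using h g kk

variable (D) in
/-- Isomorphisms of the base lift to isomorphisms with given target. -/
def IsIsofibration : Prop :=
  ∀ {x : C} (Y : D.Total) (e : x ≅ Y.base),
    ∃ (xx : D.Obj x) (i : (⟨x, xx⟩ : D.Total) ≅ Y), i.hom.base = e.hom

theorem Cleaving.isIsofibration (c : D.Cleaving) : D.IsIsofibration := by
  intro x Y e
  have h : IsCartesian _ := c.cartesian e.hom Y.fiber
  have : IsIso (homMk (c.hom e.hom Y.fiber)).base := inferInstanceAs (IsIso e.hom)
  have := IsCartesian.isIso_total (φ := homMk (c.hom e.hom Y.fiber)) h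
  exact ⟨_, asIso (homMk (c.hom e.hom Y.fiber)), rfl⟩

theorem OpCleaving.isIsofibration (c : D.OpCleaving) : D.IsIsofibration := by
  intro x Y e
  -- An opcleaving only lifts morphisms out of `Y`, so `e.inv` is lifted and the lift is then
  -- inverted.
  have h : IsOpcartesian _ := c.opcartesian e.inv Y.fiber
  have : IsIso (homMk (c.hom e.inv Y.fiber)).base := inferInstanceAs (IsIso e.inv)
  have := IsOpcartesian.isIso_total (φ := homMk (c.hom e.inv Y.fiber)) h
  refine ⟨_, (asIso (homMk (c.hom e.inv Y.fiber))).symm, ?_⟩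
  rw [← cancel_epi e.inv, Iso.inv_hom_id]
  exact total_base_hom_inv (asIso (homMk (c.hom e.inv Y.fiber)))

end Total

/-! ### Pullback of displayed categories along a functor -/

section Pullback

variable {C₁ : Type u₁} [Category.{v₁} C₁] {C₂ : Type u₂} [Category.{v₂} C₂]

/-- The pullback of a displayed category along a functor. -/
def pullback (F : C₁ ⥤ C₂) (D : DispCat.{v₂, u₂, v', u'} C₂) : DispCat.{v₁, u₁, v', u'} C₁ where
  Obj x := D.Obj (F.obj x)
  Hom f xx yy := D.Hom (F.map f) xx yy
  -- The identity of `D` lies over `𝟙 (F.obj x)` but is needed over `F.map (𝟙 x)`; composites need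
  -- the same correction.
  id xx := castHom (F.map_id _).symm (D.id xx)
  comp ff gg := castHom (F.map_comp _ _).symm (D.comp ff gg)
  id_comp _ := (castHom_heq _ _).trans
    ((D.comp_heq (F.map_id _) rfl (castHom_heq _ _) HEq.rfl).trans (D.id_comp _))
  comp_id _ := (castHom_heq _ _).trans
    ((D.comp_heq rfl (F.map_id _) HEq.rfl (castHom_heq _ _)).trans (D.comp_id _))
  assoc _ _ _ := (castHom_heq _ _).trans <|
    (D.comp_heq (F.map_comp _ _) rfl (castHom_heq _ _) HEq.rfl).trans <|
    (D.assoc _ _ _).trans <|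
    (D.comp_heq rfl (F.map_comp _ _).symm HEq.rfl (castHom_heq _ _).symm).trans
      (castHom_heq _ _).symm

variable {F : C₁ ⥤ C₂} {D : DispCat.{v₂, u₂, v', u'} C₂}

variable (F D) in
/-- The displayed functor from the pullback of a displayed category. -/
def pullbackProj : DispFunctor F (pullback F D) D where
  obj xx := xx
  map ff := ff
  map_id _ := castHom_heq _ _
  map_comp _ _ := castHom_heq _ _

/-- The universal property in the pullback is the one in `D`, restricted to base morphisms of the
form `F.map g`. -/
theorem pullback_isOpcartesian {x y : C₁} {f : x ⟶ y} {xx : D.Obj (F.obj x)}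
    {yy : D.Obj (F.obj y)} {ff : D.Hom (F.map f) xx yy} (h : IsOpcartesian ff) :
    IsOpcartesian (D := pullback F D) (f := f) ff := by
  intro z g zz hh
  obtain ⟨gg, hgg, hu⟩ := h.existsUnique_heq (F.map g) (F.map_comp f g).symm hh
  exact ⟨gg, eq_of_heq ((castHom_heq _ _).trans hgg),
    fun l hl => hu l ((castHom_heq _ _).symm.trans (heq_of_eq hl))⟩

theorem pullback_isCartesian {x y : C₁} {f : x ⟶ y} {xx : D.Obj (F.obj x)}
    {yy : D.Obj (F.obj y)} {ff : D.Hom (F.map f) xx yy} (h : IsCartesian ff) :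
    IsCartesian (D := pullback F D) (f := f) ff := by
  intro z g zz hh
  obtain ⟨gg, hgg, hu⟩ := h.existsUnique_heq (F.map g) (F.map_comp g f).symm hh
  exact ⟨gg, eq_of_heq ((castHom_heq _ _).trans hgg),
    fun l hl => hu l ((castHom_heq _ _).symm.trans (heq_of_eq hl))⟩

variable (F) in
/-- The pullback of an opcleaving. -/
def OpCleaving.pullback (c : D.OpCleaving) : (pullback F D).OpCleaving where
  obj f xx := c.obj (F.map f) xx
  hom f xx := c.hom (F.map f) xx
  opcartesian f xx := pullback_isOpcartesian (c.opcartesian (F.map f) xx)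

variable (F) in
/-- The pullback of a cleaving. -/
def Cleaving.pullback (c : D.Cleaving) : (pullback F D).Cleaving where
  obj f xx := c.obj (F.map f) xx
  hom f xx := c.hom (F.map f) xx
  cartesian f xx := pullback_isCartesian (c.cartesian (F.map f) xx)

/-- Being opcartesian in the pullback tests fewer morphisms than in `D`, so the opcleaving is
needed: the chosen lift is opcartesian in both, and `ff` differs from it by an isomorphism of the
pullback, which the projection carries to an isomorphism. -/
theorem OpCleaving.pullbackProj_isOpcartesian (c : D.OpCleaving) {x y : C₁} {f : x ⟶ y}
    {xx : (DispCat.pullback F D).Obj x} {yy : (DispCat.pullback F D).Obj y}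
    (ff : (DispCat.pullback F D).Hom f xx yy) (h : IsOpcartesian ff) :
    IsOpcartesian ((pullbackProj F D).map ff) := by
  have hc : IsOpcartesian _ := c.opcartesian (F.map f) xx
  obtain ⟨e, he⟩ := IsOpcartesian.exists_iso (D := DispCat.pullback F D)
    (φ := homMk ((c.pullback F).hom f xx)) (ψ := homMk ff) (pullback_isOpcartesian hc) h
    (Iso.refl y) (Category.comp_id _)
  have he' := congrArg (pullbackProj F D).total.map he
  rw [Functor.map_comp] at he'
  have key : IsOpcartesian (homMk (c.hom (F.map f) xx) ≫
      ((pullbackProj F D).total.mapIso e).hom).fiber :=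
    hc.total_comp (φ := homMk (c.hom (F.map f) xx)) (isOpcartesian_total_iso ((pullbackProj F D).total.mapIso e))
  change IsOpcartesian (homMk ((pullbackProj F D).map ff)).fiber
  exact IsOpcartesian.of_total_eq key he'

theorem Cleaving.pullbackProj_isCartesian (c : D.Cleaving) {x y : C₁} {f : x ⟶ y}
    {xx : (DispCat.pullback F D).Obj x} {yy : (DispCat.pullback F D).Obj y}
    (ff : (DispCat.pullback F D).Hom f xx yy) (h : IsCartesian ff) :
    IsCartesian ((pullbackProj F D).map ff) := by
  have hc : IsCartesian _ := c.cartesian (F.map f) yy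
  obtain ⟨e, he⟩ := IsCartesian.exists_iso (D := DispCat.pullback F D)
    (φ := homMk ((c.pullback F).hom f yy)) (ψ := homMk ff) (pullback_isCartesian hc) h
    (Iso.refl x) (Category.id_comp _)
  have he' := congrArg (pullbackProj F D).total.map he
  rw [Functor.map_comp] at he'
  have key : IsCartesian (((pullbackProj F D).total.mapIso e).hom ≫
      homMk (c.hom (F.map f) yy)).fiber :=
    IsCartesian.total_comp (ψ := homMk (c.hom (F.map f) yy))
      (isCartesian_total_iso ((pullbackProj F D).total.mapIso e)) hc
  change IsCartesian (homMk ((pullbackProj F D).map ff)).fiber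
  exact IsCartesian.of_total_eq key he'

end Pullback

end DispCat

/-! ### Displayed hom-categories and cartesian 1-cells -/

namespace DispBicat

variable {B : Type u} [Bicategory.{w, v} B] {D : DispBicat.{w, v, u, w', v', u'} B}

variable (D) in
/-- The displayed category of displayed 1-cells and 2-cells between two displayed objects. -/
def homDispCat {a b : B} (x : D.Obj a) (y : D.Obj b) : DispCat (a ⟶ b) where
  Obj f := D.Hom f x y
  Hom θ ff gg := D.Hom₂ θ ff gg
  id ff := D.id₂ ff
  comp ηη θθ := D.comp₂ ηη θθ
  id_comp := D.id_comp₂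
  comp_id := D.comp_id₂
  assoc := D.assoc₂

/-- A displayed invertible 2-cell as an isomorphism of the total category. -/
def isoTotal {a b : B} {f g : a ⟶ b} {e : f ≅ g} {x : D.Obj a} {y : D.Obj b}
    {ff : D.Hom f x y} {gg : D.Hom g x y} (i : D.Iso₂ e ff gg) :
    (⟨f, ff⟩ : (D.homDispCat x y).Total) ≅ ⟨g, gg⟩ where
  hom := ⟨e.hom, i.hom⟩
  inv := ⟨e.inv, i.inv⟩
  hom_inv_id := DispCat.total_ext e.hom_inv_id i.hom_inv_id
  inv_hom_id := DispCat.total_ext e.inv_hom_id i.inv_hom_id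

variable (D) in
/-- The identity displayed invertible 2-cell. -/
def isoRefl {a b : B} {f : a ⟶ b} {x : D.Obj a} {y : D.Obj b} (ff : D.Hom f x y) :
    D.Iso₂ (Iso.refl f) ff ff where
  hom := D.id₂ ff
  inv := D.id₂ ff
  hom_inv_id := D.id_comp₂ _
  inv_hom_id := D.id_comp₂ _

/-- A displayed 1-cell is cartesian if it admits lifts and right whiskering with it is bijective
on displayed 2-cells. -/
def CartesianStructure.ofBijective {a b : B} {f : a ⟶ b} {x : D.Obj a} {y : D.Obj b}
    {ff : D.Hom f x y}
    (lift : ∀ {c : B} {z : D.Obj c} (h : c ⟶ a) (gg : D.Hom (h ≫ f) z y), Lift ff h gg)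
    (bij : ∀ {c : B} {z : D.Obj c} {h₁ h₂ : c ⟶ a} (hh₁ : D.Hom h₁ z x) (hh₂ : D.Hom h₂ z x)
      (δ : h₁ ⟶ h₂), Function.Bijective
        (fun δδ : D.Hom₂ δ hh₁ hh₂ => D.whiskerRight δδ ff)) :
    CartesianStructure ff where
  lift := lift
  existsUnique_lift₂ {c z h₁ h₂ gg₁ gg₂} L₁ L₂ δ σσ := by
    let s := DispCat.homMk (D := D.homDispCat z y) σσ
    -- Solving the defining equation for the whiskered cell turns it into `δδ ▷ ff = k`, which has
    -- exactly one solution by bijectivity. The 2-cells of the lifts lie over identities, so `k`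
    -- lies over `δ ▷ f` up to unit laws.
    let k := (isoTotal L₁.iso).hom ≫ s ≫ (isoTotal L₂.iso).inv
    have hk : k.base = δ ▷ f :=
      (Category.id_comp (δ ▷ f ≫ 𝟙 _)).trans (Category.comp_id (δ ▷ f))
    have key (δδ : D.Hom₂ δ L₁.hom L₂.hom) :
        D.comp₂ (D.whiskerRight δδ ff) L₂.iso.hom ≍ D.comp₂ L₁.iso.hom σσ ↔
          D.whiskerRight δδ ff = DispCat.castHom (D := D.homDispCat z y) hk k.fiber := by
      have e : (D.whiskerRight δδ ff = DispCat.castHom (D := D.homDispCat z y) hk k.fiber) ↔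
          DispCat.homMk (D := D.homDispCat z y) (D.whiskerRight δδ ff) = k := by
        constructor
        · intro h
          exact DispCat.total_ext hk.symm ((heq_of_eq h).trans (DispCat.castHom_heq _ _))
        · intro h
          exact eq_of_heq ((DispCat.fiber_heq h).trans (DispCat.castHom_heq hk k.fiber).symm)
      have e' : DispCat.homMk (D := D.homDispCat z y) (D.whiskerRight δδ ff) = k ↔
          DispCat.homMk (D := D.homDispCat z y) (D.whiskerRight δδ ff) ≫ (isoTotal L₂.iso).hom =
            (isoTotal L₁.iso).hom ≫ s :=
        (Iff.of_eq (congrArg _ (Category.assoc _ _ _).symm)).trans (Iso.eq_comp_inv _)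
      rw [e, e']
      constructor
      · exact fun h => DispCat.total_ext
          ((Category.comp_id (δ ▷ f)).trans (Category.id_comp (δ ▷ f)).symm) h
      · exact fun h => DispCat.fiber_heq h
    simpa only [key] using (bij L₁.hom L₂.hom δ).existsUnique _

/-- Any `hh` is a lift of its own composite with `ff`, with identity 2-cell; for such lifts the
universal property is bijectivity of whiskering. -/
theorem CartesianStructure.bijective {a b : B} {f : a ⟶ b} {x : D.Obj a} {y : D.Obj b}
    {ff : D.Hom f x y} (s : CartesianStructure ff) {c : B} {z : D.Obj c} {h₁ h₂ : c ⟶ a}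
    (hh₁ : D.Hom h₁ z x) (hh₂ : D.Hom h₂ z x) (δ : h₁ ⟶ h₂) :
    Function.Bijective (fun δδ : D.Hom₂ δ hh₁ hh₂ => D.whiskerRight δδ ff) := by
  rw [Function.bijective_iff_existsUnique]
  intro σσ
  have h := s.existsUnique_lift₂ ⟨hh₁, D.isoRefl (D.comp hh₁ ff)⟩ ⟨hh₂, D.isoRefl (D.comp hh₂ ff)⟩
    δ σσ
  have key (δδ : D.Hom₂ δ hh₁ hh₂) :
      D.comp₂ (D.whiskerRight δδ ff) (D.id₂ (D.comp hh₂ ff)) ≍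
        D.comp₂ (D.id₂ (D.comp hh₁ ff)) σσ ↔ D.whiskerRight δδ ff = σσ := by
    rw [← heq_iff_eq]
    constructor
    · exact fun h => (D.comp_id₂ _).symm.trans (h.trans (D.id_comp₂ _))
    · exact fun h => (D.comp_id₂ _).trans (h.trans (D.id_comp₂ _).symm)
  simpa only [isoRefl, key] using h

/-- Only the order of the bound variables differs. This gives 2-cells access to the results on total
categories. -/
theorem isOpcartesian₂_iff {a b : B} {f g : a ⟶ b} {θ : f ⟶ g} {x : D.Obj a} {y : D.Obj b}
    {ff : D.Hom f x y} {gg : D.Hom g x y} {θθ : D.Hom₂ θ ff gg} :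
    IsOpcartesian₂ θθ ↔ DispCat.IsOpcartesian (D := D.homDispCat x y) θθ :=
  ⟨fun h _ τ _ γγ => h τ γγ, fun h _ _ τ γγ => h τ γγ⟩

theorem isCartesian₂_iff {a b : B} {f g : a ⟶ b} {θ : f ⟶ g} {x : D.Obj a} {y : D.Obj b}
    {ff : D.Hom f x y} {gg : D.Hom g x y} {θθ : D.Hom₂ θ ff gg} :
    IsCartesian₂ θθ ↔ DispCat.IsCartesian (D := D.homDispCat x y) θθ :=
  ⟨fun h _ τ _ γγ => h τ γγ, fun h _ _ τ γγ => h τ γγ⟩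

/-- Two opcartesian 2-cells with the same source over the same 2-cell differ by an
isomorphism. -/
theorem IsOpcartesian₂.exists_iso {a b : B} {f g : a ⟶ b} {θ : f ⟶ g} {x : D.Obj a} {y : D.Obj b}
    {ff : D.Hom f x y} {gg gg' : D.Hom g x y} {θθ : D.Hom₂ θ ff gg} {θθ' : D.Hom₂ θ ff gg'}
    (h : IsOpcartesian₂ θθ) (h' : IsOpcartesian₂ θθ') :
    ∃ e : (⟨g, gg⟩ : (D.homDispCat x y).Total) ≅ ⟨g, gg'⟩,
      DispCat.homMk (D := D.homDispCat x y) θθ ≫ e.hom =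
        DispCat.homMk (D := D.homDispCat x y) θθ' :=
  DispCat.IsOpcartesian.exists_iso (D := D.homDispCat x y)
    (φ := DispCat.homMk (D := D.homDispCat x y) θθ)
    (ψ := DispCat.homMk (D := D.homDispCat x y) θθ') (isOpcartesian₂_iff.1 h)
    (isOpcartesian₂_iff.1 h') (Iso.refl g) (Category.comp_id _)

/-- Two cartesian 2-cells with the same target over the same 2-cell differ by an isomorphism. -/
theorem IsCartesian₂.exists_iso {a b : B} {f g : a ⟶ b} {θ : f ⟶ g} {x : D.Obj a} {y : D.Obj b}
    {ff ff' : D.Hom f x y} {gg : D.Hom g x y} {θθ : D.Hom₂ θ ff gg} {θθ' : D.Hom₂ θ ff' gg}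
    (h : IsCartesian₂ θθ) (h' : IsCartesian₂ θθ') :
    ∃ e : (⟨f, ff'⟩ : (D.homDispCat x y).Total) ≅ ⟨f, ff⟩,
      e.hom ≫ DispCat.homMk (D := D.homDispCat x y) θθ =
        DispCat.homMk (D := D.homDispCat x y) θθ' :=
  DispCat.IsCartesian.exists_iso (D := D.homDispCat x y)
    (φ := DispCat.homMk (D := D.homDispCat x y) θθ)
    (ψ := DispCat.homMk (D := D.homDispCat x y) θθ') (isCartesian₂_iff.1 h)
    (isCartesian₂_iff.1 h') (Iso.refl f) (Category.id_comp _)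

end DispBicat

/-! ### Pointwise lifts of natural transformations -/

namespace DispCat

section Pushforward

variable {C₁ : Type u₁} [Category.{v₁} C₁] {C₂ : Type u₂} [Category.{v₂} C₂]
  {D₁ : DispCat.{v₁, u₁, v', u'} C₁} {D₂ : DispCat.{v₂, u₂, v', u'} C₂} {F G : C₁ ⥤ C₂}

namespace OpCleaving

variable (c : D₂.OpCleaving) (θ : F ⟶ G) (FF : DispFunctor F D₁ D₂)

/-- By naturality of `θ`, the right-hand composite lies over `θ.app x ≫ G.map f`, so it factors
through the opcartesian lift at `x`. -/
theorem existsUnique_pushforwardMap {x y : C₁} {f : x ⟶ y} {xx : D₁.Obj x} {yy : D₁.Obj y}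
    (ff : D₁.Hom f xx yy) :
    ∃! gg : D₂.Hom (G.map f) (c.obj (θ.app x) (FF.obj xx)) (c.obj (θ.app y) (FF.obj yy)),
      D₂.comp (c.hom (θ.app x) (FF.obj xx)) gg ≍
        D₂.comp (FF.map ff) (c.hom (θ.app y) (FF.obj yy)) :=
  IsOpcartesian.existsUnique_heq (c.opcartesian (θ.app x) (FF.obj xx)) (G.map f) (θ.naturality f).symm _

/-- The action on morphisms of `pushforward`. -/
noncomputable def pushforwardMap {x y : C₁} {f : x ⟶ y} {xx : D₁.Obj x} {yy : D₁.Obj y}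
    (ff : D₁.Hom f xx yy) :
    D₂.Hom (G.map f) (c.obj (θ.app x) (FF.obj xx)) (c.obj (θ.app y) (FF.obj yy)) :=
  (c.existsUnique_pushforwardMap θ FF ff).choose

theorem pushforwardMap_spec {x y : C₁} {f : x ⟶ y} {xx : D₁.Obj x} {yy : D₁.Obj y}
    (ff : D₁.Hom f xx yy) :
    homMk (c.hom (θ.app x) (FF.obj xx)) ≫ homMk (c.pushforwardMap θ FF ff) =
      homMk (FF.map ff) ≫ homMk (c.hom (θ.app y) (FF.obj yy)) :=
  total_ext (θ.naturality f).symm (c.existsUnique_pushforwardMap θ FF ff).choose_spec.1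

/-- The target of the pointwise opcartesian lift of a natural transformation. -/
noncomputable def pushforward : DispFunctor G D₁ D₂ where
  obj {x} xx := c.obj (θ.app x) (FF.obj xx)
  map ff := c.pushforwardMap θ FF ff
  map_id {x} xx := by
    refine fiber_heq (φ := homMk (c.pushforwardMap θ FF (D₁.id xx))) (ψ := 𝟙 _) ?_
    have h : IsOpcartesian (homMk (c.hom (θ.app x) (FF.obj xx))).fiber := c.opcartesian _ _
    -- Functoriality may be checked after precomposing with the opcartesian lift at `x`, where
    -- `pushforwardMap_spec` computes both sides.
    refine h.total_hom_ext (G.map_id x) ?_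
    rw [pushforwardMap_spec, Category.comp_id,
      show homMk (FF.map (D₁.id xx)) = 𝟙 _ from total_ext (F.map_id x) (FF.map_id xx),
      Category.id_comp]
  map_comp {x y z f g xx yy zz} ff gg := by
    refine fiber_heq (φ := homMk (c.pushforwardMap θ FF (D₁.comp ff gg)))
      (ψ := homMk (c.pushforwardMap θ FF ff) ≫ homMk (c.pushforwardMap θ FF gg)) ?_
    have h : IsOpcartesian (homMk (c.hom (θ.app x) (FF.obj xx))).fiber := c.opcartesian _ _
    refine h.total_hom_ext (G.map_comp f g) ?_
    rw [pushforwardMap_spec, ← Category.assoc, pushforwardMap_spec, Category.assoc,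
      pushforwardMap_spec, ← Category.assoc,
      show homMk (FF.map (D₁.comp ff gg)) = homMk (FF.map ff) ≫ homMk (FF.map gg) from
        total_ext (F.map_comp f g) (FF.map_comp ff gg)]

/-- The pointwise opcartesian lift of a natural transformation. -/
noncomputable def toPushforward : DispNatTrans θ FF (c.pushforward θ FF) where
  app {x} xx := c.hom (θ.app x) (FF.obj xx)
  naturality ff := fiber_heq (c.pushforwardMap_spec θ FF ff).symm

/-- In the naturality square of the lift, the composite through `FF.map ff` is opcartesian;
cancelling the lift at `x` leaves the pushed-forward morphism. -/
theorem pushforward_isOpcartesian {x y : C₁} {f : x ⟶ y} {xx : D₁.Obj x} {yy : D₁.Obj y}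
    (ff : D₁.Hom f xx yy) (h : IsOpcartesian (FF.map ff)) :
    IsOpcartesian ((c.pushforward θ FF).map ff) := by
  have hx : IsOpcartesian (homMk (c.hom (θ.app x) (FF.obj xx))).fiber := c.opcartesian _ _
  have hy : IsOpcartesian (homMk (c.hom (θ.app y) (FF.obj yy))).fiber := c.opcartesian _ _
  have h' : IsOpcartesian (homMk (FF.map ff)).fiber := h
  change IsOpcartesian (homMk (c.pushforwardMap θ FF ff)).fiber
  exact IsOpcartesian.of_total_comp hx
    (IsOpcartesian.of_total_eq (h'.total_comp hy) (c.pushforwardMap_spec θ FF ff).symm)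

end OpCleaving

namespace Cleaving

variable (c : D₂.Cleaving) (θ : F ⟶ G) (GG : DispFunctor G D₁ D₂)

/-- Dual to the pushforward: the factorization is now through the cartesian lift at the target `y`.
-/
theorem existsUnique_reindexMap {x y : C₁} {f : x ⟶ y} {xx : D₁.Obj x} {yy : D₁.Obj y}
    (ff : D₁.Hom f xx yy) :
    ∃! gg : D₂.Hom (F.map f) (c.obj (θ.app x) (GG.obj xx)) (c.obj (θ.app y) (GG.obj yy)),
      D₂.comp gg (c.hom (θ.app y) (GG.obj yy)) ≍
        D₂.comp (c.hom (θ.app x) (GG.obj xx)) (GG.map ff) :=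
  IsCartesian.existsUnique_heq (c.cartesian (θ.app y) (GG.obj yy)) (F.map f) (θ.naturality f) _

/-- The action on morphisms of `reindex`. -/
noncomputable def reindexMap {x y : C₁} {f : x ⟶ y} {xx : D₁.Obj x} {yy : D₁.Obj y}
    (ff : D₁.Hom f xx yy) :
    D₂.Hom (F.map f) (c.obj (θ.app x) (GG.obj xx)) (c.obj (θ.app y) (GG.obj yy)) :=
  (c.existsUnique_reindexMap θ GG ff).choose

theorem reindexMap_spec {x y : C₁} {f : x ⟶ y} {xx : D₁.Obj x} {yy : D₁.Obj y}
    (ff : D₁.Hom f xx yy) :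
    homMk (c.reindexMap θ GG ff) ≫ homMk (c.hom (θ.app y) (GG.obj yy)) =
      homMk (c.hom (θ.app x) (GG.obj xx)) ≫ homMk (GG.map ff) :=
  total_ext (θ.naturality f) (c.existsUnique_reindexMap θ GG ff).choose_spec.1

/-- The source of the pointwise cartesian lift of a natural transformation. -/
noncomputable def reindex : DispFunctor F D₁ D₂ where
  obj {x} xx := c.obj (θ.app x) (GG.obj xx)
  map ff := c.reindexMap θ GG ff
  map_id {x} xx := by
    refine fiber_heq (φ := homMk (c.reindexMap θ GG (D₁.id xx))) (ψ := 𝟙 _) ?_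
    have h : IsCartesian (homMk (c.hom (θ.app x) (GG.obj xx))).fiber := c.cartesian _ _
    refine h.total_hom_ext (F.map_id x) ?_
    rw [reindexMap_spec, Category.id_comp,
      show homMk (GG.map (D₁.id xx)) = 𝟙 _ from total_ext (G.map_id x) (GG.map_id xx),
      Category.comp_id]
  map_comp {x y z f g xx yy zz} ff gg := by
    refine fiber_heq (φ := homMk (c.reindexMap θ GG (D₁.comp ff gg)))
      (ψ := homMk (c.reindexMap θ GG ff) ≫ homMk (c.reindexMap θ GG gg)) ?_
    have h : IsCartesian (homMk (c.hom (θ.app z) (GG.obj zz))).fiber := c.cartesian _ _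
    refine h.total_hom_ext (F.map_comp f g) ?_
    rw [reindexMap_spec, Category.assoc, reindexMap_spec, ← Category.assoc,
      reindexMap_spec, Category.assoc,
      show homMk (GG.map (D₁.comp ff gg)) = homMk (GG.map ff) ≫ homMk (GG.map gg) from
        total_ext (G.map_comp f g) (GG.map_comp ff gg)]

/-- The pointwise cartesian lift of a natural transformation. -/
noncomputable def fromReindex : DispNatTrans θ (c.reindex θ GG) GG where
  app {x} xx := c.hom (θ.app x) (GG.obj xx)
  naturality ff := fiber_heq (c.reindexMap_spec θ GG ff)

theorem reindex_isCartesian {x y : C₁} {f : x ⟶ y} {xx : D₁.Obj x} {yy : D₁.Obj y}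
    (ff : D₁.Hom f xx yy) (h : IsCartesian (GG.map ff)) :
    IsCartesian ((c.reindex θ GG).map ff) := by
  have hx : IsCartesian (homMk (c.hom (θ.app x) (GG.obj xx))).fiber := c.cartesian _ _
  have hy : IsCartesian (homMk (c.hom (θ.app y) (GG.obj yy))).fiber := c.cartesian _ _
  have h' : IsCartesian (homMk (GG.map ff)).fiber := h
  change IsCartesian (homMk (c.reindexMap θ GG ff)).fiber
  exact IsCartesian.of_total_comp hy
    (IsCartesian.of_total_eq (hx.total_comp h') (c.reindexMap_spec θ GG ff).symm)

end Cleaving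

end Pushforward

end DispCat

open DispCat

/-! ### Universal property of pointwise opcartesian and cartesian transformations -/

namespace DispNatTrans

variable {C₁ : Type u₁} [Category.{v₁} C₁] {C₂ : Type u₂} [Category.{v₂} C₂]
  {D₁ : DispCat.{v₁, u₁, v', u'} C₁} {D₂ : DispCat.{v₂, u₂, v', u'} C₂} {F G H : C₁ ⥤ C₂}
  {FF : DispFunctor F D₁ D₂} {GG : DispFunctor G D₁ D₂} {HH : DispFunctor H D₁ D₂}

theorem existsUnique_comp_of_isOpcartesian {α : F ⟶ G} (αα : DispNatTrans α FF GG)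
    (h : ∀ {x : C₁} (xx : D₁.Obj x), IsOpcartesian (αα.app xx)) (β : G ⟶ H)
    (γγ : DispNatTrans (α ≫ β) FF HH) : ∃! ββ : DispNatTrans β GG HH, αα.comp ββ = γγ := by
  choose t ht hu using fun (x : C₁) (xx : D₁.Obj x) => h xx (β.app x) (γγ.app xx)
  have hL {x : C₁} (xx : D₁.Obj x) : IsOpcartesian (homMk (αα.app xx)).fiber := h xx
  have hmk {x : C₁} (xx : D₁.Obj x) :
      homMk (αα.app xx) ≫ homMk (t x xx) = homMk (γγ.app xx) :=
    total_ext rfl (heq_of_eq (ht x xx))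
  refine ⟨⟨fun {x} xx => t x xx, fun {x y f xx yy} ff => ?_⟩, ?_, ?_⟩
  · refine fiber_heq (φ := homMk (GG.map ff) ≫ homMk (t y yy))
      (ψ := homMk (t x xx) ≫ homMk (HH.map ff)) ?_
    -- The componentwise factorizations are natural because their naturality squares agree after
    -- precomposition with the opcartesian `αα.app xx`.
    refine IsOpcartesian.total_hom_ext (hL xx) (β.naturality f) ?_
    have e₁ : homMk (FF.map ff) ≫ homMk (αα.app yy) = homMk (αα.app xx) ≫ homMk (GG.map ff) :=
      total_ext (α.naturality f) (αα.naturality ff)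
    have e₂ : homMk (FF.map ff) ≫ homMk (γγ.app yy) = homMk (γγ.app xx) ≫ homMk (HH.map ff) :=
      total_ext ((α ≫ β).naturality f) (γγ.naturality ff)
    rw [← hmk, ← hmk, ← Category.assoc, e₁, Category.assoc, Category.assoc] at e₂
    exact e₂
  · exact DispNatTrans.ext (by ext x xx; exact ht x xx)
  · intro σ hσ
    refine DispNatTrans.ext ?_
    ext x xx
    exact hu x xx _ (congrArg (fun k : DispNatTrans (α ≫ β) FF HH => k.app xx) hσ)

theorem existsUnique_comp_of_isCartesian {β : G ⟶ H} (ββ : DispNatTrans β GG HH)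
    (h : ∀ {x : C₁} (xx : D₁.Obj x), IsCartesian (ββ.app xx)) (α : F ⟶ G)
    (γγ : DispNatTrans (α ≫ β) FF HH) : ∃! αα : DispNatTrans α FF GG, αα.comp ββ = γγ := by
  choose t ht hu using fun (x : C₁) (xx : D₁.Obj x) => h xx (α.app x) (γγ.app xx)
  have hL {x : C₁} (xx : D₁.Obj x) : IsCartesian (homMk (ββ.app xx)).fiber := h xx
  have hmk {x : C₁} (xx : D₁.Obj x) :
      homMk (t x xx) ≫ homMk (ββ.app xx) = homMk (γγ.app xx) :=
    total_ext rfl (heq_of_eq (ht x xx))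
  refine ⟨⟨fun {x} xx => t x xx, fun {x y f xx yy} ff => ?_⟩, ?_, ?_⟩
  · refine fiber_heq (φ := homMk (FF.map ff) ≫ homMk (t y yy))
      (ψ := homMk (t x xx) ≫ homMk (GG.map ff)) ?_
    refine IsCartesian.total_hom_ext (hL yy) (α.naturality f) ?_
    have e₁ : homMk (GG.map ff) ≫ homMk (ββ.app yy) = homMk (ββ.app xx) ≫ homMk (HH.map ff) :=
      total_ext (β.naturality f) (ββ.naturality ff)
    have e₂ : homMk (FF.map ff) ≫ homMk (γγ.app yy) = homMk (γγ.app xx) ≫ homMk (HH.map ff) :=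
      total_ext ((α ≫ β).naturality f) (γγ.naturality ff)
    rw [← hmk, ← hmk, Category.assoc, ← e₁, ← Category.assoc, ← Category.assoc] at e₂
    exact e₂
  · exact DispNatTrans.ext (by ext x xx; exact ht x xx)
  · intro σ hσ
    refine DispNatTrans.ext ?_
    ext x xx
    exact hu x xx _ (congrArg (fun k : DispNatTrans (α ≫ β) FF HH => k.app xx) hσ)

end DispNatTrans

/-! ### Local lifts and stability under whiskering -/

section TwoCells

variable {C₁ C₂ C₃ : Cat.{v, u}} {D₁ : DispCat.{v, u, v, u} C₁} {D₂ : DispCat.{v, u, v, u} C₂}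

theorem isOpcartesian₂_of_app {F G : C₁ ⟶ C₂} {θ : F ⟶ G} {FF : DispFunctor F.toFunctor D₁ D₂}
    {GG : DispFunctor G.toFunctor D₁ D₂} (θθ : DispNatTrans θ.toNatTrans FF GG)
    (h : ∀ {x : C₁} (xx : D₁.Obj x), IsOpcartesian (θθ.app xx)) :
    DispBicat.IsOpcartesian₂ (D := dispCatBicat.{v, u}) (θ := θ) (ff := FF) (gg := GG) θθ :=
  fun τ γγ => θθ.existsUnique_comp_of_isOpcartesian h τ.toNatTrans γγ

theorem isCartesian₂_of_app {F G : C₁ ⟶ C₂} {θ : F ⟶ G} {FF : DispFunctor F.toFunctor D₁ D₂}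
    {GG : DispFunctor G.toFunctor D₁ D₂} (θθ : DispNatTrans θ.toNatTrans FF GG)
    (h : ∀ {x : C₁} (xx : D₁.Obj x), IsCartesian (θθ.app xx)) :
    DispBicat.IsCartesian₂ (D := dispCatBicat.{v, u}) (θ := θ) (ff := FF) (gg := GG) θθ :=
  fun τ γγ => θθ.existsUnique_comp_of_isCartesian h τ.toNatTrans γγ

/-- The local opcleaving of `OpCleav`. -/
noncomputable def opCleavLocalOpcleaving : OpCleav.{v, u}.LocalOpcleaving where
  hom θ _ y ff := ⟨OpCleaving.pushforward y.2 θ.toNatTrans ff.1, fun {_ _ _ _ _} hh h =>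
    OpCleaving.pushforward_isOpcartesian y.2 θ.toNatTrans ff.1 hh (ff.2 hh h)⟩
  hom₂ θ _ y ff := OpCleaving.toPushforward y.2 θ.toNatTrans ff.1
  opcartesian θ _ y ff _ _ τ γγ := isOpcartesian₂_of_app
    (OpCleaving.toPushforward y.2 θ.toNatTrans ff.1)
    (fun _ => OpCleaving.opcartesian y.2 _ _) τ γγ

/-- The local cleaving of `Cleav`. -/
noncomputable def cleavLocalCleaving : Cleav.{v, u}.LocalCleaving where
  hom θ _ y gg := ⟨Cleaving.reindex y.2 θ.toNatTrans gg.1, fun {_ _ _ _ _} hh h =>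
    Cleaving.reindex_isCartesian y.2 θ.toNatTrans gg.1 hh (gg.2 hh h)⟩
  hom₂ θ _ y gg := Cleaving.fromReindex y.2 θ.toNatTrans gg.1
  cartesian θ _ y gg _ _ τ γγ := isCartesian₂_of_app
    (Cleaving.fromReindex y.2 θ.toNatTrans gg.1)
    (fun _ => Cleaving.cartesian y.2 _ _) τ γγ

/-- Evaluation of the 1-cells of `OpCleav` at an object of the total category. -/
def opCleavEval (c₁ : D₁.OpCleaving) (c₂ : D₂.OpCleaving) (X : D₁.Total) :
    (OpCleav.{v, u}.homDispCat (a := C₁) (b := C₂) ⟨D₁, c₁⟩ ⟨D₂, c₂⟩).Total ⥤ D₂.Total where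
  obj FF := ⟨FF.base.toFunctor.obj X.base, DispFunctor.obj FF.fiber.1 X.fiber⟩
  map αα := ⟨αα.base.toNatTrans.app X.base, DispNatTrans.app αα.fiber X.fiber⟩

/-- Evaluation of the 1-cells of `Cleav` at an object of the total category. -/
def cleavEval (c₁ : D₁.Cleaving) (c₂ : D₂.Cleaving) (X : D₁.Total) :
    (Cleav.{v, u}.homDispCat (a := C₁) (b := C₂) ⟨D₁, c₁⟩ ⟨D₂, c₂⟩).Total ⥤ D₂.Total where
  obj FF := ⟨FF.base.toFunctor.obj X.base, DispFunctor.obj FF.fiber.1 X.fiber⟩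
  map αα := ⟨αα.base.toNatTrans.app X.base, DispNatTrans.app αα.fiber X.fiber⟩

/-- Opcartesian 2-cells of `OpCleav` are pointwise opcartesian. -/
theorem isOpcartesian_app_of_isOpcartesian₂ {F G : C₁ ⟶ C₂} {θ : F ⟶ G}
    {c₁ : D₁.OpCleaving} {c₂ : D₂.OpCleaving} {ff : OpCleav.{v, u}.Hom F ⟨D₁, c₁⟩ ⟨D₂, c₂⟩}
    {gg : OpCleav.{v, u}.Hom G ⟨D₁, c₁⟩ ⟨D₂, c₂⟩} (θθ : OpCleav.{v, u}.Hom₂ θ ff gg)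
    (h : DispBicat.IsOpcartesian₂ θθ) {t : C₁} (tt : D₁.Obj t) :
    DispCat.IsOpcartesian (DispNatTrans.app θθ tt) := by
  obtain ⟨e, he⟩ := DispBicat.IsOpcartesian₂.exists_iso
    (opCleavLocalOpcleaving.opcartesian θ ff) h
  let ev := opCleavEval c₁ c₂ ⟨t, tt⟩
  have he' := congrArg ev.map he
  rw [Functor.map_comp] at he'
  have h₁ : IsOpcartesian (ev.map (homMk (D := OpCleav.{v, u}.homDispCat (a := C₁) (b := C₂) ⟨D₁, c₁⟩ ⟨D₂, c₂⟩)
    (opCleavLocalOpcleaving.hom₂ θ ff))).fiber := OpCleaving.opcartesian c₂ _ _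
  change IsOpcartesian (ev.map (homMk (D := OpCleav.{v, u}.homDispCat (a := C₁) (b := C₂)
    ⟨D₁, c₁⟩ ⟨D₂, c₂⟩) θθ)).fiber
  exact IsOpcartesian.of_total_eq (h₁.total_comp (isOpcartesian_total_iso (ev.mapIso e))) he'

/-- Cartesian 2-cells of `Cleav` are pointwise cartesian. -/
theorem isCartesian_app_of_isCartesian₂ {F G : C₁ ⟶ C₂} {θ : F ⟶ G}
    {c₁ : D₁.Cleaving} {c₂ : D₂.Cleaving} {ff : Cleav.{v, u}.Hom F ⟨D₁, c₁⟩ ⟨D₂, c₂⟩}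
    {gg : Cleav.{v, u}.Hom G ⟨D₁, c₁⟩ ⟨D₂, c₂⟩} (θθ : Cleav.{v, u}.Hom₂ θ ff gg)
    (h : DispBicat.IsCartesian₂ θθ) {t : C₁} (tt : D₁.Obj t) :
    DispCat.IsCartesian (DispNatTrans.app θθ tt) := by
  obtain ⟨e, he⟩ := DispBicat.IsCartesian₂.exists_iso
    (cleavLocalCleaving.cartesian θ gg) h
  let ev := cleavEval c₁ c₂ ⟨t, tt⟩
  have he' := congrArg ev.map he
  rw [Functor.map_comp] at he'
  have h₁ : IsCartesian (ev.map (homMk (D := Cleav.{v, u}.homDispCat (a := C₁) (b := C₂) ⟨D₁, c₁⟩ ⟨D₂, c₂⟩)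
    (cleavLocalCleaving.hom₂ θ gg))).fiber := Cleaving.cartesian c₂ _ _
  change IsCartesian (ev.map (homMk (D := Cleav.{v, u}.homDispCat (a := C₁) (b := C₂)
    ⟨D₁, c₁⟩ ⟨D₂, c₂⟩) θθ)).fiber
  exact IsCartesian.of_total_eq
    (IsCartesian.total_comp (isCartesian_total_iso (ev.mapIso e)) h₁) he'

/-- The components of the whiskered cell are among those of `ηη`. -/
theorem opCleav_whiskerLeft_isOpcartesian₂ {a b c : Cat.{v, u}} {f : a ⟶ b} {g h : b ⟶ c}
    {η : g ⟶ h} {x : OpCleav.{v, u}.Obj a} {y : OpCleav.{v, u}.Obj b} {z : OpCleav.{v, u}.Obj c}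
    (ff : OpCleav.{v, u}.Hom f x y) {gg : OpCleav.{v, u}.Hom g y z}
    {hh : OpCleav.{v, u}.Hom h y z} (ηη : OpCleav.{v, u}.Hom₂ η gg hh)
    (H : DispBicat.IsOpcartesian₂ ηη) :
    DispBicat.IsOpcartesian₂ (OpCleav.{v, u}.whiskerLeft ff ηη) := fun τ γγ =>
  isOpcartesian₂_of_app (DispNatTrans.whiskerLeft ff.1 ηη)
    (fun _ => isOpcartesian_app_of_isOpcartesian₂ ηη H _) τ γγ

/-- The components are images under `hh` of those of `ηη`, and `hh` preserves opcartesian morphisms.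
-/
theorem opCleav_whiskerRight_isOpcartesian₂ {a b c : Cat.{v, u}} {f g : a ⟶ b} {h : b ⟶ c}
    {η : f ⟶ g} {x : OpCleav.{v, u}.Obj a} {y : OpCleav.{v, u}.Obj b} {z : OpCleav.{v, u}.Obj c}
    {ff gg} (ηη : OpCleav.{v, u}.Hom₂ η (x := x) (y := y) ff gg)
    (hh : OpCleav.{v, u}.Hom h y z) (H : DispBicat.IsOpcartesian₂ ηη) :
    DispBicat.IsOpcartesian₂ (OpCleav.{v, u}.whiskerRight ηη hh) := fun τ γγ =>
  isOpcartesian₂_of_app (DispNatTrans.whiskerRight ηη hh.1)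
    (fun _ => hh.2 _ (isOpcartesian_app_of_isOpcartesian₂ ηη H _)) τ γγ

theorem cleav_whiskerLeft_isCartesian₂ {a b c : Cat.{v, u}} {f : a ⟶ b} {g h : b ⟶ c}
    {η : g ⟶ h} {x : Cleav.{v, u}.Obj a} {y : Cleav.{v, u}.Obj b} {z : Cleav.{v, u}.Obj c}
    (ff : Cleav.{v, u}.Hom f x y) {gg : Cleav.{v, u}.Hom g y z}
    {hh : Cleav.{v, u}.Hom h y z} (ηη : Cleav.{v, u}.Hom₂ η gg hh)
    (H : DispBicat.IsCartesian₂ ηη) :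
    DispBicat.IsCartesian₂ (Cleav.{v, u}.whiskerLeft ff ηη) := fun τ γγ =>
  isCartesian₂_of_app (DispNatTrans.whiskerLeft ff.1 ηη)
    (fun _ => isCartesian_app_of_isCartesian₂ ηη H _) τ γγ

theorem cleav_whiskerRight_isCartesian₂ {a b c : Cat.{v, u}} {f g : a ⟶ b} {h : b ⟶ c}
    {η : f ⟶ g} {x : Cleav.{v, u}.Obj a} {y : Cleav.{v, u}.Obj b} {z : Cleav.{v, u}.Obj c}
    {ff gg} (ηη : Cleav.{v, u}.Hom₂ η (x := x) (y := y) ff gg)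
    (hh : Cleav.{v, u}.Hom h y z) (H : DispBicat.IsCartesian₂ ηη) :
    DispBicat.IsCartesian₂ (Cleav.{v, u}.whiskerRight ηη hh) := fun τ γγ =>
  isCartesian₂_of_app (DispNatTrans.whiskerRight ηη hh.1)
    (fun _ => hh.2 _ (isCartesian_app_of_isCartesian₂ ηη H _)) τ γγ

end TwoCells

/-! ### Global cleavings by pullback -/

section PullbackCartesian

variable {C₁ : Type u₁} [Category.{v₁} C₁] {C₂ : Type u₂} [Category.{v₂} C₂]
  {C₃ : Type u₃} [Category.{v₃} C₃]
  {D₁ : DispCat.{v₁, u₁, v', u'} C₁} {D₃ : DispCat.{v₃, u₃, v', u'} C₃}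

/-- The displayed functor to a pullback induced by a displayed functor over a composite. -/
def pullbackLift {H : C₁ ⥤ C₂} {F : C₂ ⥤ C₃} (GG : DispFunctor (H ⋙ F) D₁ D₃) :
    DispFunctor H D₁ (DispCat.pullback F D₃) where
  obj xx := GG.obj xx
  map ff := GG.map ff
  map_id xx := (GG.map_id xx).trans (castHom_heq (F.map_id _).symm _).symm
  map_comp ff gg := (GG.map_comp ff gg).trans (castHom_heq (F.map_comp _ _).symm _).symm

theorem pullbackLift_isOpcartesian {H : C₁ ⥤ C₂} {F : C₂ ⥤ C₃} (GG : DispFunctor (H ⋙ F) D₁ D₃)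
    {x y : C₁} {f : x ⟶ y} {xx : D₁.Obj x} {yy : D₁.Obj y} (ff : D₁.Hom f xx yy)
    (h : IsOpcartesian (GG.map ff)) : IsOpcartesian ((pullbackLift GG).map ff) :=
  fun {_} g _ hh => pullback_isOpcartesian (F := F) (f := H.map f) h g hh

theorem pullbackLift_isCartesian {H : C₁ ⥤ C₂} {F : C₂ ⥤ C₃} (GG : DispFunctor (H ⋙ F) D₁ D₃)
    {x y : C₁} {f : x ⟶ y} {xx : D₁.Obj x} {yy : D₁.Obj y} (ff : D₁.Hom f xx yy)
    (h : IsCartesian (GG.map ff)) : IsCartesian ((pullbackLift GG).map ff) :=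
  fun {_} g _ hh => pullback_isCartesian (F := F) (f := H.map f) h g hh

/-- Both sides have the same components; their naturality conditions differ only by transport. -/
theorem bijective_whiskerRight_pullbackProj {H₁ H₂ : C₁ ⥤ C₂} (F : C₂ ⥤ C₃) (δ : H₁ ⟶ H₂)
    (HH₁ : DispFunctor H₁ D₁ (DispCat.pullback F D₃))
    (HH₂ : DispFunctor H₂ D₁ (DispCat.pullback F D₃)) :
    Function.Bijective (fun δδ : DispNatTrans δ HH₁ HH₂ =>
      DispNatTrans.whiskerRight δδ (pullbackProj F D₃)) := by
  constructor
  · intro σ τ h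
    refine DispNatTrans.ext ?_
    ext x xx
    exact congrArg (fun k : DispNatTrans (Functor.whiskerRight δ F)
      (HH₁.comp (pullbackProj F D₃)) (HH₂.comp (pullbackProj F D₃)) => k.app xx) h
  · intro σσ
    exact ⟨⟨fun xx => σσ.app xx, fun ff => (castHom_heq (F.map_comp _ _).symm _).trans
      ((σσ.naturality ff).trans (castHom_heq (F.map_comp _ _).symm _).symm)⟩, rfl⟩

/-- The global cleaving of `OpCleav` by pullbacks. -/
def opCleavGlobalCleaving : OpCleav.{v, u}.GlobalCleaving where
  obj f y := ⟨DispCat.pullback f.toFunctor y.1, OpCleaving.pullback f.toFunctor y.2⟩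
  hom f y := ⟨pullbackProj f.toFunctor y.1, fun {_ _ _ _ _} ff h =>
    OpCleaving.pullbackProj_isOpcartesian y.2 ff h⟩
  cartesian f _ := DispBicat.CartesianStructure.ofBijective
    (fun h gg =>
      { hom := ⟨pullbackLift (H := h.toFunctor) (F := f.toFunctor) gg.1,
          fun {_ _ _ _ _} ff hff => pullbackLift_isOpcartesian gg.1 ff (gg.2 ff hff)⟩
        -- The lift composed with the projection is `gg` on the nose.
        iso := OpCleav.{v, u}.isoRefl gg })
    (fun hh₁ hh₂ δ => bijective_whiskerRight_pullbackProj f.toFunctor δ.toNatTrans hh₁.1 hh₂.1)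

/-- The global cleaving of `Cleav` by pullbacks. -/
def cleavGlobalCleaving : Cleav.{v, u}.GlobalCleaving where
  obj f y := ⟨DispCat.pullback f.toFunctor y.1, Cleaving.pullback f.toFunctor y.2⟩
  hom f y := ⟨pullbackProj f.toFunctor y.1, fun {_ _ _ _ _} ff h =>
    Cleaving.pullbackProj_isCartesian y.2 ff h⟩
  cartesian f _ := DispBicat.CartesianStructure.ofBijective
    (fun h gg =>
      { hom := ⟨pullbackLift (H := h.toFunctor) (F := f.toFunctor) gg.1,
          fun {_ _ _ _ _} ff hff => pullbackLift_isCartesian gg.1 ff (gg.2 ff hff)⟩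
        iso := Cleav.{v, u}.isoRefl gg })
    (fun hh₁ hh₂ δ => bijective_whiskerRight_pullbackProj f.toFunctor δ.toNatTrans hh₁.1 hh₂.1)

end PullbackCartesian

/-! ### Testing displayed functors against the point -/

section Point

theorem isOpcartesian_castHom {C : Type u} [Category.{v} C] {D : DispCat.{v, u, v', u'} C}
    {x y : C} {f g : x ⟶ y} (h : f = g) {xx : D.Obj x} {yy : D.Obj y} {ff : D.Hom f xx yy}
    (hf : IsOpcartesian ff) : IsOpcartesian (castHom h ff) := by
  subst h
  exact hf

theorem isCartesian_castHom {C : Type u} [Category.{v} C] {D : DispCat.{v, u, v', u'} C}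
    {x y : C} {f g : x ⟶ y} (h : f = g) {xx : D.Obj x} {yy : D.Obj y} {ff : D.Hom f xx yy}
    (hf : IsCartesian ff) : IsCartesian (castHom h ff) := by
  subst h
  exact hf

/-- The category with one object and one morphism. -/
inductive Point : Type u
  | pt

instance pointCategory : Category.{v} Point.{u} where
  Hom _ _ := PUnit.{v + 1}
  id _ := ⟨⟩
  comp _ _ := ⟨⟩

/-- The terminal displayed category over the point. -/
def pointDisp : DispCat.{v, u, v', u'} Point.{u} where
  Obj _ := PUnit.{u' + 1}
  Hom _ _ _ := PUnit.{v' + 1}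
  id _ := ⟨⟩
  comp _ _ := ⟨⟩
  id_comp _ := HEq.rfl
  comp_id _ := HEq.rfl
  assoc _ _ _ := HEq.rfl

/-- The opcleaving of the terminal displayed category over the point. -/
def pointOpCleaving : (pointDisp.{v, u, v', u'}).OpCleaving where
  obj _ _ := ⟨⟩
  hom _ _ := ⟨⟩
  opcartesian _ _ _ _ _ _ := ⟨⟨⟩, rfl, fun _ _ => rfl⟩

/-- The cleaving of the terminal displayed category over the point. -/
def pointCleaving : (pointDisp.{v, u, v', u'}).Cleaving where
  obj _ _ := ⟨⟩
  hom _ _ := ⟨⟩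
  cartesian _ _ _ _ _ _ := ⟨⟨⟩, rfl, fun _ _ => rfl⟩

variable {C : Type u} [Category.{v} C] {D : DispCat.{v, u, v', u'} C}

/-- The functor from the point with a given value. -/
def pointFunctor (x : C) : Point ⥤ C where
  obj _ := x
  map _ := 𝟙 x

/-- The natural transformation between functors from the point with a given component. -/
def pointNatTrans {x y : C} (f : x ⟶ y) : pointFunctor x ⟶ pointFunctor y where
  app _ := f
  naturality _ _ _ := (Category.id_comp f).trans (Category.comp_id f).symm

/-- The displayed functor from the point with a given value. -/
def pointDispFunctor {x : C} (xx : D.Obj x) :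
    DispFunctor (pointFunctor x) (pointDisp.{v, u, v', u'}) D where
  obj _ := xx
  map _ := D.id xx
  map_id _ := HEq.rfl
  map_comp _ _ := (D.id_comp _).symm

/-- The displayed natural transformation between displayed functors from the point with a given
component. -/
def pointDispNatTrans {x y : C} {f : x ⟶ y} {xx : D.Obj x} {yy : D.Obj y} (ff : D.Hom f xx yy) :
    DispNatTrans (pointNatTrans f) (pointDispFunctor xx) (pointDispFunctor yy) where
  app _ := ff
  naturality _ := (D.id_comp ff).trans (D.comp_id ff).symm

theorem pointDispFunctor_isOpcartesian {x : C} (xx : D.Obj x) {p q : Point.{u}} {f : p ⟶ q}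
    {pp : (pointDisp.{v, u, v', u'}).Obj p} {qq : (pointDisp.{v, u, v', u'}).Obj q}
    (ff : (pointDisp.{v, u, v', u'}).Hom f pp qq) :
    IsOpcartesian ((pointDispFunctor xx).map ff) :=
  fun {_} g _ hh => isOpcartesian_total_iso (Iso.refl (⟨x, xx⟩ : D.Total)) g hh

theorem pointDispFunctor_isCartesian {x : C} (xx : D.Obj x) {p q : Point.{u}} {f : p ⟶ q}
    {pp : (pointDisp.{v, u, v', u'}).Obj p} {qq : (pointDisp.{v, u, v', u'}).Obj q}
    (ff : (pointDisp.{v, u, v', u'}).Hom f pp qq) :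
    IsCartesian ((pointDispFunctor xx).map ff) :=
  fun {_} g _ hh => isCartesian_total_iso (Iso.refl (⟨x, xx⟩ : D.Total)) g hh

variable {C₁ : Type u} [Category.{v} C₁] {C₂ : Type u₂} [Category.{v₂} C₂]
  {D₁ : DispCat.{v, u, v', u'} C₁} {D₂ : DispCat.{v₂, u₂, v', u'} C₂}

namespace DispFunctor

variable {F : C₁ ⥤ C₂} (FF : DispFunctor F D₁ D₂)

/-- A displayed functor is fully faithful if it is bijective on displayed morphisms over any
given morphism. -/
def FullyFaithful : Prop :=
  ∀ {x y : C₁} (f : x ⟶ y) (xx : D₁.Obj x) (yy : D₁.Obj y),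
    Function.Bijective (fun ff : D₁.Hom f xx yy => FF.map ff)

/-- A displayed functor is essentially surjective if every displayed object over an object in the
image of the base functor is isomorphic, over the identity, to one in its image. -/
def EssSurj : Prop :=
  ∀ {x : C₁} (yy : D₂.Obj (F.obj x)), ∃ (xx : D₁.Obj x)
    (e : (⟨F.obj x, FF.obj xx⟩ : D₂.Total) ≅ ⟨F.obj x, yy⟩), e.hom.base = 𝟙 (F.obj x)

/-- Displayed transformations between constant functors from the point are exactly displayed
morphisms, since naturality reduces to unit laws. Whiskering with `FF` then becomes its action on
morphisms. -/
theorem fullyFaithful_of_whiskerRight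
    (h : ∀ {x y : C₁} (f : x ⟶ y) (xx : D₁.Obj x) (yy : D₁.Obj y),
      Function.Bijective (fun δδ : DispNatTrans (pointNatTrans f) (pointDispFunctor xx)
        (pointDispFunctor yy) => DispNatTrans.whiskerRight δδ FF)) : FF.FullyFaithful := by
  intro x y f xx yy
  constructor
  · intro k l hkl
    have := @(h f xx yy).1 (pointDispNatTrans k) (pointDispNatTrans l)
      (DispNatTrans.ext (by ext; exact hkl))
    exact congrArg (fun t : DispNatTrans (pointNatTrans f) (pointDispFunctor xx)
      (pointDispFunctor yy) => t.app (x := Point.pt) ⟨⟩) this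
  · intro g
    have hx : FF.map (D₁.id xx) ≍ D₂.id (FF.obj xx) := FF.map_id xx
    have hy : FF.map (D₁.id yy) ≍ D₂.id (FF.obj yy) := FF.map_id yy
    obtain ⟨δ, hδ⟩ := (h f xx yy).2 ⟨fun _ => g, fun _ =>
      ((D₂.comp_heq (F.map_id x) rfl hx HEq.rfl).trans (D₂.id_comp g)).trans
        ((D₂.comp_heq rfl (F.map_id y) HEq.rfl hy).trans (D₂.comp_id g)).symm⟩
    exact ⟨δ.app (x := Point.pt) ⟨⟩, congrArg (fun t : DispNatTrans
      (Functor.whiskerRight (pointNatTrans f) F) ((pointDispFunctor xx).comp FF)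
      ((pointDispFunctor yy).comp FF) => t.app (x := Point.pt) ⟨⟩) hδ⟩

end DispFunctor

end Point

/-! ### Cartesian 1-cells are fully faithful and essentially surjective -/

section CartesianFunctors

variable {C₁ C₂ : Cat.{v, u}} {D₁ : DispCat.{v, u, v, u} C₁} {D₂ : DispCat.{v, u, v, u} C₂}
  {F : C₁ ⟶ C₂}

theorem fullyFaithful_of_opCleav {c₁ : D₁.OpCleaving} {c₂ : D₂.OpCleaving}
    {FF : OpCleav.{v, u}.Hom F ⟨D₁, c₁⟩ ⟨D₂, c₂⟩} (s : DispBicat.CartesianStructure FF) :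
    DispFunctor.FullyFaithful FF.1 :=
  DispFunctor.fullyFaithful_of_whiskerRight FF.1 fun f xx yy =>
    s.bijective (c := Cat.of Point.{u}) (z := ⟨pointDisp, pointOpCleaving⟩)
      (h₁ := ⟨pointFunctor _⟩) (h₂ := ⟨pointFunctor _⟩)
      ⟨pointDispFunctor xx, fun {_ _ _ _ _} ff _ => pointDispFunctor_isOpcartesian xx ff⟩
      ⟨pointDispFunctor yy, fun {_ _ _ _ _} ff _ => pointDispFunctor_isOpcartesian yy ff⟩
      ⟨pointNatTrans f⟩

theorem fullyFaithful_of_cleav {c₁ : D₁.Cleaving} {c₂ : D₂.Cleaving}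
    {FF : Cleav.{v, u}.Hom F ⟨D₁, c₁⟩ ⟨D₂, c₂⟩} (s : DispBicat.CartesianStructure FF) :
    DispFunctor.FullyFaithful FF.1 :=
  DispFunctor.fullyFaithful_of_whiskerRight FF.1 fun f xx yy =>
    s.bijective (c := Cat.of Point.{u}) (z := ⟨pointDisp, pointCleaving⟩)
      (h₁ := ⟨pointFunctor _⟩) (h₂ := ⟨pointFunctor _⟩)
      ⟨pointDispFunctor xx, fun {_ _ _ _ _} ff _ => pointDispFunctor_isCartesian xx ff⟩
      ⟨pointDispFunctor yy, fun {_ _ _ _ _} ff _ => pointDispFunctor_isCartesian yy ff⟩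
      ⟨pointNatTrans f⟩

/-- A displayed object over the value of `F` at `x`, as a displayed functor from the point. -/
def pointDispFunctorComp {x : C₁} (yy : D₂.Obj (F.toFunctor.obj x)) :
    DispFunctor (pointFunctor x ⋙ F.toFunctor) (pointDisp.{v, u, v, u}) D₂ where
  obj _ := yy
  -- The base functor sends the morphism of the point to `F.map (𝟙 x)`, which is only
  -- propositionally an identity.
  map _ := castHom (F.toFunctor.map_id x).symm (D₂.id yy)
  map_id _ := castHom_heq _ _
  map_comp _ _ := (castHom_heq _ _).trans <| (D₂.id_comp _).symm.trans
    (D₂.comp_heq (F.toFunctor.map_id x).symm (F.toFunctor.map_id x).symm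
      (castHom_heq _ _).symm (castHom_heq _ _).symm)

/-- Lifting `yy`, viewed as a functor from the point, gives the object `xx`; evaluating the
invertible 2-cell of the lift gives the isomorphism, which lies over an identity. -/
theorem essSurj_of_opCleav {c₁ : D₁.OpCleaving} {c₂ : D₂.OpCleaving}
    {FF : OpCleav.{v, u}.Hom F ⟨D₁, c₁⟩ ⟨D₂, c₂⟩} (s : DispBicat.CartesianStructure FF) :
    DispFunctor.EssSurj FF.1 := by
  intro x yy
  let L := s.lift (c := Cat.of Point.{u}) (z := ⟨pointDisp, pointOpCleaving⟩)
    ⟨pointFunctor x⟩ ⟨pointDispFunctorComp yy, fun {_ _ _ _ _} _ _ =>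
      isOpcartesian_castHom (D := D₂) (F.toFunctor.map_id x).symm
        (isOpcartesian_total_iso (Iso.refl (⟨_, yy⟩ : D₂.Total)))⟩
  let e := (opCleavEval (C₁ := Cat.of Point) pointOpCleaving c₂ ⟨Point.pt, ⟨⟩⟩).mapIso (DispBicat.isoTotal L.iso)
  exact ⟨DispFunctor.obj L.hom.1 (x := Point.pt) ⟨⟩, e, rfl⟩

theorem essSurj_of_cleav {c₁ : D₁.Cleaving} {c₂ : D₂.Cleaving}
    {FF : Cleav.{v, u}.Hom F ⟨D₁, c₁⟩ ⟨D₂, c₂⟩} (s : DispBicat.CartesianStructure FF) :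
    DispFunctor.EssSurj FF.1 := by
  intro x yy
  let L := s.lift (c := Cat.of Point.{u}) (z := ⟨pointDisp, pointCleaving⟩)
    ⟨pointFunctor x⟩ ⟨pointDispFunctorComp yy, fun {_ _ _ _ _} _ _ =>
      isCartesian_castHom (D := D₂) (F.toFunctor.map_id x).symm
        (isCartesian_total_iso (Iso.refl (⟨_, yy⟩ : D₂.Total)))⟩
  let e := (cleavEval (C₁ := Cat.of Point) pointCleaving c₂ ⟨Point.pt, ⟨⟩⟩).mapIso (DispBicat.isoTotal L.iso)
  exact ⟨DispFunctor.obj L.hom.1 (x := Point.pt) ⟨⟩, e, rfl⟩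

end CartesianFunctors

/-! ### The pseudofunctor of total categories -/

section TotalPseudofunctor

/-- This equation and the next two are the components of the coherence laws for the left unitor, the
right unitor and the associator; every factor is an identity or the image of one. -/
theorem DispFunctor.total_map_id_eq₃ {C₁ : Type u₁} [Category.{v₁} C₁] {C₂ : Type u₂}
    [Category.{v₂} C₂] {D₁ : DispCat.{v₁, u₁, v', u'} C₁} {D₂ : DispCat.{v₂, u₂, v', u'} C₂}
    {F : C₁ ⥤ C₂} (FF : DispFunctor F D₁ D₂) (X : D₁.Total) :
    𝟙 (FF.total.obj X) = 𝟙 _ ≫ FF.total.map (𝟙 X) ≫ 𝟙 _ := by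
  simp

theorem DispFunctor.total_id_comp_id_eq {C₁ : Type u₁} [Category.{v₁} C₁] {C₂ : Type u₂}
    [Category.{v₂} C₂] {D₁ : DispCat.{v₁, u₁, v', u'} C₁} {D₂ : DispCat.{v₂, u₂, v', u'} C₂}
    {F : C₁ ⥤ C₂} (FF : DispFunctor F D₁ D₂) (X : D₁.Total) :
    𝟙 (FF.total.obj X) = 𝟙 _ ≫ 𝟙 _ ≫ 𝟙 _ := by
  simp

theorem DispFunctor.total_comp_map_id_eq {C₁ : Type u₁} [Category.{v₁} C₁] {C₂ : Type u₂}
    [Category.{v₂} C₂] {C₃ : Type u₃} [Category.{v₃} C₃] {C₄ : Type u₄} [Category.{v₄} C₄]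
    {D₁ : DispCat.{v₁, u₁, v', u'} C₁} {D₂ : DispCat.{v₂, u₂, v', u'} C₂}
    {D₃ : DispCat.{v₃, u₃, v', u'} C₃} {D₄ : DispCat.{v₄, u₄, v', u'} C₄}
    {F : C₁ ⥤ C₂} {G : C₂ ⥤ C₃} {H : C₃ ⥤ C₄} (FF : DispFunctor F D₁ D₂)
    (GG : DispFunctor G D₂ D₃) (HH : DispFunctor H D₃ D₄) (X : D₁.Total) :
    𝟙 (HH.total.obj (GG.total.obj (FF.total.obj X))) =
      𝟙 _ ≫ HH.total.map (𝟙 (GG.total.obj (FF.total.obj X))) ≫ 𝟙 _ ≫ 𝟙 _ ≫ 𝟙 _ := by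
  simp

theorem arrowHom₂_cat_hext {C₁ C₂ : Cat.{v, u}} {F G : C₁ ⟶ C₂} {θ θ' : F ⟶ G}
    {h₁ : ArrowObj C₁} {h₂ : ArrowObj C₂} {s₁ : ArrowHom F h₁ h₂} {s₂ : ArrowHom G h₁ h₂}
    {τ : ArrowHom₂ θ s₁ s₂} {τ' : ArrowHom₂ θ' s₁ s₂} (h : θ = θ')
    (happ : ∀ X, τ.top.toNatTrans.app X = τ'.top.toNatTrans.app X) : τ ≍ τ' :=
  ArrowHom₂.hext h (Cat.Hom₂.ext (NatTrans.ext (funext happ)))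

variable {C₁ C₂ C₃ : Cat.{v, u}} {D₁ : DispCat.{v, u, v, u} C₁} {D₂ : DispCat.{v, u, v, u} C₂}
  {D₃ : DispCat.{v, u, v, u} C₃}

/-- The total square of an identity is the identity square. -/
def totalSquareId (D : DispCat.{v, u, v, u} C₁) :
    (arrow Cat.{v, u}).Iso₂ ((Pseudofunctor.id Cat.{v, u}).mapId C₁)
      (totalSquare (F := 𝟙 C₁) (DispFunctor.id D)) (ArrowHom.id (projArrow D)) where
  hom :=
    { top := 𝟙 (𝟙 (totalCat D))
      comm := Cat.Hom₂.ext <| NatTrans.ext <| funext fun X => by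
        change 𝟙 X.base ≫ 𝟙 X.base = 𝟙 X.base ≫ 𝟙 X.base ≫ 𝟙 X.base
        simp }
  inv :=
    { top := 𝟙 (𝟙 (totalCat D))
      comm := Cat.Hom₂.ext <| NatTrans.ext <| funext fun X => by
        change (𝟙 X.base ≫ 𝟙 X.base) ≫ 𝟙 X.base = 𝟙 X.base ≫ 𝟙 X.base
        simp }
  hom_inv_id := arrowHom₂_cat_hext (Iso.hom_inv_id _) fun _ => Category.id_comp _
  inv_hom_id := arrowHom₂_cat_hext (Iso.inv_hom_id _) fun _ => Category.id_comp _

/-- The total square of a composite is the composite of the total squares. -/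
def totalSquareComp {F : C₁ ⟶ C₂} {G : C₂ ⟶ C₃} (FF : DispFunctor F.toFunctor D₁ D₂)
    (GG : DispFunctor G.toFunctor D₂ D₃) :
    (arrow Cat.{v, u}).Iso₂ ((Pseudofunctor.id Cat.{v, u}).mapComp F G)
      (totalSquare (F := F ≫ G) (FF.comp GG)) ((totalSquare FF).comp (totalSquare GG)) where
  hom :=
    { top := 𝟙 (totalSquare (F := F ≫ G) (FF.comp GG)).top
      comm := Cat.Hom₂.ext <| NatTrans.ext <| funext fun X => by
        -- Both fillings and all associators of `Cat` have identity components, so the pasted square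
        -- reduces to identities and one `G.toFunctor.map` of an identity.
        change 𝟙 (G.toFunctor.obj (F.toFunctor.obj X.base)) ≫ 𝟙 _ =
          𝟙 _ ≫ 𝟙 _ ≫ G.toFunctor.map (𝟙 (F.toFunctor.obj X.base)) ≫ 𝟙 _ ≫ 𝟙 _ ≫ 𝟙 _
        simp }
  inv :=
    { top := 𝟙 (totalSquare (F := F ≫ G) (FF.comp GG)).top
      comm := Cat.Hom₂.ext <| NatTrans.ext <| funext fun X => by
        change (𝟙 (G.toFunctor.obj (F.toFunctor.obj X.base)) ≫
          G.toFunctor.map (𝟙 (F.toFunctor.obj X.base)) ≫ 𝟙 _ ≫ 𝟙 _ ≫ 𝟙 _) ≫ 𝟙 _ = 𝟙 _ ≫ 𝟙 _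
        simp }
  hom_inv_id := arrowHom₂_cat_hext (Iso.hom_inv_id _) fun _ => Category.id_comp _
  inv_hom_id := arrowHom₂_cat_hext (Iso.inv_hom_id _) fun _ => Category.id_comp _

/-- The displayed pseudofunctor of total categories. -/
def totalPseudofunctor : DispPseudofunctor (Pseudofunctor.id Cat.{v, u}) dispCatBicat.{v, u}
    (arrow Cat.{v, u}) where
  toDispCellMap := totalCellMap
  mapId D := totalSquareId D
  mapComp FF GG := totalSquareComp FF GG
  map₂_id _ := arrowHom₂_cat_hext rfl fun _ => rfl
  map₂_comp _ _ := arrowHom₂_cat_hext rfl fun _ => rfl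
  map₂_whiskerLeft _ _ _ _ :=
    arrowHom₂_cat_hext (Pseudofunctor.map₂_whisker_left _ _ _) fun _ =>
      ((Category.id_comp _).trans (Category.comp_id _)).symm
  map₂_whiskerRight _ _ :=
    arrowHom₂_cat_hext (Pseudofunctor.map₂_whisker_right _ _ _) fun _ =>
      ((Category.id_comp _).trans (Category.comp_id _)).symm
  map₂_associator FF GG HH :=
    arrowHom₂_cat_hext (Pseudofunctor.map₂_associator _ _ _ _) fun X =>
      DispFunctor.total_comp_map_id_eq FF GG HH X
  map₂_leftUnitor FF :=
    arrowHom₂_cat_hext (Pseudofunctor.map₂_left_unitor _ _) fun X =>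
      DispFunctor.total_map_id_eq₃ FF X
  map₂_rightUnitor FF :=
    arrowHom₂_cat_hext (Pseudofunctor.map₂_right_unitor _ _) fun X =>
      DispFunctor.total_id_comp_id_eq FF X

end TotalPseudofunctor

/-- The displayed pseudofunctor of total categories on `OpCleav`. -/
def opCleavPseudofunctor : DispPseudofunctor (Pseudofunctor.id Cat.{v, u}) OpCleav.{v, u}
    (arrow Cat.{v, u}) where
  toDispCellMap := opCleavCellMap
  mapId D := totalPseudofunctor.mapId D.1
  mapComp FF GG := totalPseudofunctor.mapComp FF.1 GG.1
  map₂_id FF := totalPseudofunctor.map₂_id FF.1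
  map₂_comp αα ββ := totalPseudofunctor.map₂_comp αα ββ
  map₂_whiskerLeft FF _ _ αα := totalPseudofunctor.map₂_whiskerLeft FF.1 αα
  map₂_whiskerRight αα HH := totalPseudofunctor.map₂_whiskerRight αα HH.1
  map₂_associator FF GG HH := totalPseudofunctor.map₂_associator FF.1 GG.1 HH.1
  map₂_leftUnitor FF := totalPseudofunctor.map₂_leftUnitor FF.1
  map₂_rightUnitor FF := totalPseudofunctor.map₂_rightUnitor FF.1

/-- The displayed pseudofunctor of total categories on `Cleav`. -/
def cleavPseudofunctor : DispPseudofunctor (Pseudofunctor.id Cat.{v, u}) Cleav.{v, u}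
    (arrow Cat.{v, u}) where
  toDispCellMap := cleavCellMap
  mapId D := totalPseudofunctor.mapId D.1
  mapComp FF GG := totalPseudofunctor.mapComp FF.1 GG.1
  map₂_id FF := totalPseudofunctor.map₂_id FF.1
  map₂_comp αα ββ := totalPseudofunctor.map₂_comp αα ββ
  map₂_whiskerLeft FF _ _ αα := totalPseudofunctor.map₂_whiskerLeft FF.1 αα
  map₂_whiskerRight αα HH := totalPseudofunctor.map₂_whiskerRight αα HH.1
  map₂_associator FF GG HH := totalPseudofunctor.map₂_associator FF.1 GG.1 HH.1
  map₂_leftUnitor FF := totalPseudofunctor.map₂_leftUnitor FF.1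
  map₂_rightUnitor FF := totalPseudofunctor.map₂_rightUnitor FF.1

/-! ### Preservation of opcartesian and cartesian 2-cells -/

namespace DispNatTrans

variable {C₁ : Type u₁} [Category.{v₁} C₁] {C₂ : Type u₂} [Category.{v₂} C₂]
  {D₁ : DispCat.{v₁, u₁, v', u'} C₁} {D₂ : DispCat.{v₂, u₂, v', u'} C₂} {F G H : C₁ ⥤ C₂}

/-- A 1-cell of the arrow bicategory is an arbitrary functor `T` between total categories that lies
over `H` only up to a 2-cell `σ`. The condition on projections is the compatibility required of
2-cells there, and it fixes the base of each component of `t`. -/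
theorem existsUnique_total_comp_of_isOpcartesian {FF : DispFunctor F D₁ D₂}
    {GG : DispFunctor G D₁ D₂} {α : F ⟶ G} (αα : DispNatTrans α FF GG)
    (h : ∀ {x : C₁} (xx : D₁.Obj x), IsOpcartesian (αα.app xx)) (T : D₁.Total ⥤ D₂.Total)
    (σ : D₁.proj ⋙ H ⟶ T ⋙ D₂.proj) (β : G ⟶ H) (γ : FF.total ⟶ T)
    (w : ∀ X, D₂.proj.map (γ.app X) = (α.app X.base ≫ β.app X.base) ≫ σ.app X) :
    ∃! t : GG.total ⟶ T, (∀ X, D₂.proj.map (t.app X) = β.app X.base ≫ σ.app X) ∧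
      αα.total ≫ t = γ := by
  have hL (X : D₁.Total) : IsOpcartesian (αα.total.app X).fiber := h X.fiber
  choose t ht hu using fun X => IsOpcartesian.existsUnique_total (hL X) (γ.app X)
    (β.app X.base ≫ σ.app X) ((Category.assoc _ _ _).symm.trans (w X).symm)
  refine ⟨⟨t, fun X Y φ => ?_⟩, ⟨fun X => (ht X).1, ?_⟩, fun s ⟨hs, hs'⟩ => ?_⟩
  · refine IsOpcartesian.total_hom_ext (hL X) ?_ ?_
    -- On bases, naturality of `t` is naturality of `β` whiskered with the projection and followed
    -- by `σ`.
    · exact (congrArg (G.map φ.base ≫ ·) (ht Y).1).trans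
        (((Functor.whiskerLeft D₁.proj β ≫ σ).naturality φ).trans
          (congrArg (· ≫ D₂.proj.map (T.map φ)) (ht X).1.symm))
    · rw [← Category.assoc, ← αα.total.naturality, Category.assoc, (ht Y).2, γ.naturality,
        ← Category.assoc, (ht X).2]
  · ext X
    exact (ht X).2
  · ext X
    exact hu X _ ⟨hs X, congrArg (fun k => NatTrans.app k X) hs'⟩

/-- Here `T` is the source of the factorization, so `σ` points from `T` to the strict side; it will
be the inverse of the filling of a square. -/
theorem existsUnique_total_comp_of_isCartesian {GG : DispFunctor G D₁ D₂}
    {HH : DispFunctor H D₁ D₂} {β : G ⟶ H} (ββ : DispNatTrans β GG HH)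
    (h : ∀ {x : C₁} (xx : D₁.Obj x), IsCartesian (ββ.app xx)) (T : D₁.Total ⥤ D₂.Total)
    (σ : T ⋙ D₂.proj ⟶ D₁.proj ⋙ F) (α : F ⟶ G) (γ : T ⟶ HH.total)
    (w : ∀ X, D₂.proj.map (γ.app X) = σ.app X ≫ α.app X.base ≫ β.app X.base) :
    ∃! t : T ⟶ GG.total, (∀ X, D₂.proj.map (t.app X) = σ.app X ≫ α.app X.base) ∧
      t ≫ ββ.total = γ := by
  have hL (X : D₁.Total) : IsCartesian (ββ.total.app X).fiber := h X.fiber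
  choose t ht hu using fun X => IsCartesian.existsUnique_total (hL X) (γ.app X)
    (σ.app X ≫ α.app X.base) ((Category.assoc _ _ _).trans (w X).symm)
  refine ⟨⟨t, fun X Y φ => ?_⟩, ⟨fun X => (ht X).1, ?_⟩, fun s ⟨hs, hs'⟩ => ?_⟩
  · refine IsCartesian.total_hom_ext (hL Y) ?_ ?_
    · exact (congrArg (D₂.proj.map (T.map φ) ≫ ·) (ht Y).1).trans
        (((σ ≫ Functor.whiskerLeft D₁.proj α).naturality φ).trans
          (congrArg (· ≫ G.map φ.base) (ht X).1.symm))
    · rw [Category.assoc, (ht Y).2, γ.naturality, Category.assoc, ββ.total.naturality,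
        ← Category.assoc, (ht X).2]
  · ext X
    exact (ht X).2
  · ext X
    exact hu X _ ⟨hs X, congrArg (fun k => NatTrans.app k X) hs'⟩

end DispNatTrans

section TwoCells

variable {C₁ C₂ : Cat.{v, u}} {D₁ : DispCat.{v, u, v, u} C₁} {D₂ : DispCat.{v, u, v, u} C₂}
  {F G : C₁ ⟶ C₂} {θ : F ⟶ G} {FF : DispFunctor F.toFunctor D₁ D₂}
  {GG : DispFunctor G.toFunctor D₁ D₂} (θθ : DispNatTrans θ.toNatTrans FF GG)

theorem totalSquare₂_isOpcartesian₂
    (h : ∀ {x : C₁} (xx : D₁.Obj x), IsOpcartesian (θθ.app xx)) :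
    DispBicat.IsOpcartesian₂ (D := arrow Cat.{v, u}) (totalSquare₂ θθ) := by
  intro H S τ γγ
  have hc (X : D₁.Total) := congrArg (fun k => k.toNatTrans.app X) γγ.comm
  obtain ⟨t, ⟨ht, ht'⟩, hu⟩ := θθ.existsUnique_total_comp_of_isOpcartesian h S.top.toFunctor
    S.iso.hom.toNatTrans τ.toNatTrans γγ.top.toNatTrans
    -- The source square is filled by the identity, so compatibility of `γγ` is the required base
    -- equation up to a unit law.
    (fun X => (Category.id_comp _).symm.trans (hc X))
  refine ⟨⟨⟨t⟩, ?_⟩, ?_, fun s hs => ?_⟩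
  · exact Cat.Hom₂.ext <| NatTrans.ext <| funext fun X => (Category.id_comp _).trans (ht X)
  · exact ArrowHom₂.ext (Cat.Hom₂.ext ht')
  · refine ArrowHom₂.ext (Cat.Hom₂.ext (hu _ ⟨fun X => ?_, ?_⟩))
    · exact (Category.id_comp _).symm.trans (congrArg (fun k => k.toNatTrans.app X) s.comm)
    · exact congrArg (fun k => k.top.toNatTrans) hs

theorem totalSquare₂_isCartesian₂
    (h : ∀ {x : C₁} (xx : D₁.Obj x), IsCartesian (θθ.app xx)) :
    DispBicat.IsCartesian₂ (D := arrow Cat.{v, u}) (totalSquare₂ θθ) := by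
  intro H S τ γγ
  let e : D₁.proj ⋙ H.toFunctor ≅ S.top.toFunctor ⋙ D₂.proj :=
    { hom := S.iso.hom.toNatTrans
      inv := S.iso.inv.toNatTrans
      hom_inv_id := congrArg (fun k => k.toNatTrans) S.iso.hom_inv_id
      inv_hom_id := congrArg (fun k => k.toNatTrans) S.iso.inv_hom_id }
  -- The filling of `S` stands on the left of the compatibility equation and is moved across by
  -- inverting it; the target square contributes only the trailing identity.
  have key (X : D₁.Total) {y : C₂} (p : (S.top.toFunctor ⋙ D₂.proj).obj X ⟶ y)
      (q : (D₁.proj ⋙ H.toFunctor).obj X ⟶ y) :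
      p = e.inv.app X ≫ q ↔ e.hom.app X ≫ p = q ≫ 𝟙 _ := by
    rw [Category.comp_id]
    exact Iso.eq_inv_comp (e.app X)
  obtain ⟨t, ⟨ht, ht'⟩, hu⟩ := θθ.existsUnique_total_comp_of_isCartesian h S.top.toFunctor
    e.inv τ.toNatTrans γγ.top.toNatTrans
    (fun X => (key X _ _).2 (congrArg (fun k => k.toNatTrans.app X) γγ.comm))
  refine ⟨⟨⟨t⟩, ?_⟩, ?_, fun s hs => ?_⟩
  · exact Cat.Hom₂.ext <| NatTrans.ext <| funext fun X => (key X _ _).1 (ht X)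
  · exact ArrowHom₂.ext (Cat.Hom₂.ext ht')
  · refine ArrowHom₂.ext (Cat.Hom₂.ext (hu _ ⟨fun X => ?_, ?_⟩))
    · exact (key X _ _).2 (congrArg (fun k => k.toNatTrans.app X) s.comm)
    · exact congrArg (fun k => k.top.toNatTrans) hs

end TwoCells

/-! ### Lifting functors and transformations along a total functor -/

namespace DispFunctor

section Plain

variable {C₁ : Type u₁} [Category.{v₁} C₁] {C₂ : Type u₂} [Category.{v₂} C₂]
  {Z : Type u₃} [Category.{v₃} Z] {D₁ : DispCat.{v₁, u₁, v', u'} C₁}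
  {D₂ : DispCat.{v₂, u₂, v', u'} C₂} {F : C₁ ⥤ C₂} {FF : DispFunctor F D₁ D₂}

theorem FullyFaithful.existsUnique_total (h : FF.FullyFaithful) {X Y : D₁.Total}
    (f : X.base ⟶ Y.base) (g : FF.total.obj X ⟶ FF.total.obj Y) (w : g.base = F.map f) :
    ∃! k : X ⟶ Y, k.base = f ∧ FF.total.map k = g := by
  obtain ⟨gb, gf⟩ := g
  subst w
  obtain ⟨k, hk, hu⟩ := (h f X.fiber Y.fiber).existsUnique gf
  refine ⟨⟨f, k⟩, ⟨rfl, total_ext rfl (heq_of_eq hk)⟩, ?_⟩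
  rintro ⟨_, l⟩ ⟨rfl, hl⟩
  exact total_ext rfl (heq_of_eq (hu l (eq_of_heq (fiber_heq hl))))

theorem FullyFaithful.total_hom_ext (h : FF.FullyFaithful) {X Y : D₁.Total} {k l : X ⟶ Y}
    (hb : k.base = l.base) (hk : FF.total.map k = FF.total.map l) : k = l :=
  (h.existsUnique_total l.base (FF.total.map l) rfl).unique ⟨hb, hk⟩ ⟨rfl, rfl⟩

/-- Essential surjectivity only concerns objects lying exactly over `F.obj x`; the isofibration
property first transports `Y` there along `e`. -/
theorem EssSurj.exists_total_iso (h : FF.EssSurj) (h' : D₂.IsIsofibration) (x : C₁)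
    (Y : D₂.Total) (e : F.obj x ≅ Y.base) :
    ∃ (xx : D₁.Obj x) (j : FF.total.obj ⟨x, xx⟩ ≅ Y), j.hom.base = e.hom := by
  obtain ⟨yy, i, hi⟩ := h' Y e
  obtain ⟨xx, i', hi'⟩ := h yy
  refine ⟨xx, i' ≪≫ i, ?_⟩
  change i'.hom.base ≫ i.hom.base = e.hom
  rw [hi, hi', Category.id_comp]

/-- Each component is the unique preimage over `β.app z`; naturality is checked on bases and after
applying `FF.total`. -/
theorem FullyFaithful.existsUnique_whiskerRight_total (h : FF.FullyFaithful)
    {L₁ L₂ : Z ⥤ D₁.Total} (β : L₁ ⋙ D₁.proj ⟶ L₂ ⋙ D₁.proj)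
    (σ : L₁ ⋙ FF.total ⟶ L₂ ⋙ FF.total)
    (w : ∀ z, D₂.proj.map (σ.app z) = F.map (β.app z)) :
    ∃! t : L₁ ⟶ L₂, (∀ z, D₁.proj.map (t.app z) = β.app z) ∧
      Functor.whiskerRight t FF.total = σ := by
  choose t ht hu using fun z => h.existsUnique_total (X := L₁.obj z) (Y := L₂.obj z) (β.app z)
    (σ.app z) (w z)
  refine ⟨⟨t, fun z z' u => ?_⟩, ⟨fun z => (ht z).1, ?_⟩, fun s ⟨hs, hs'⟩ => ?_⟩
  · refine h.total_hom_ext ?_ ?_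
    · exact (congrArg (D₁.proj.map (L₁.map u) ≫ ·) (ht z').1).trans
        ((β.naturality u).trans (congrArg (· ≫ D₁.proj.map (L₂.map u)) (ht z).1.symm))
    · rw [Functor.map_comp, Functor.map_comp, (ht z).2, (ht z').2]
      exact σ.naturality u
  · ext z
    exact (ht z).2
  · ext z
    exact hu z _ ⟨hs z, congrArg (fun k => NatTrans.app k z) hs'⟩

/-- The objects of `L` are chosen over those of `H` with isomorphisms `j` to `G`. Conjugating `G.map
u` by `j` gives its image under `FF.total`, and faithfulness makes the preimages functorial. -/
theorem FullyFaithful.exists_total_lift (h : FF.FullyFaithful) (hs : FF.EssSurj)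
    (hi : D₂.IsIsofibration) (H : Z ⥤ C₁) (G : Z ⥤ D₂.Total) (γ : H ⋙ F ≅ G ⋙ D₂.proj) :
    ∃ (L : Z ⥤ D₁.Total) (i : H ≅ L ⋙ D₁.proj) (j : L ⋙ FF.total ≅ G),
      ∀ z, F.map (i.hom.app z) ≫ D₂.proj.map (j.hom.app z) = γ.hom.app z := by
  choose xx j hj using fun z => hs.exists_total_iso hi (H.obj z) (G.obj z) (γ.app z)
  have hj' (z : Z) : (j z).inv.base = γ.inv.app z := by
    have e := total_base_inv_hom (j z)
    rw [hj z] at e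
    exact (Iso.eq_comp_inv (γ.app z)).2 e |>.trans (Category.id_comp _)
  -- As `j` lies over `γ`, naturality of `γ` places the conjugate over `F.map (H.map u)`, as full
  -- faithfulness requires.
  have hw {z z' : Z} (u : z ⟶ z') :
      ((j z).hom ≫ G.map u ≫ (j z').inv).base = F.map (H.map u) := by
    change (j z).hom.base ≫ D₂.proj.map (G.map u) ≫ (j z').inv.base = _
    rw [hj z, hj' z']
    exact (Category.assoc _ _ _).symm.trans
      ((Iso.comp_inv_eq (γ.app z')).2 (γ.hom.naturality u).symm)
  choose m hm hu using fun (z z' : Z) (u : z ⟶ z') => h.existsUnique_total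
    (X := ⟨H.obj z, xx z⟩) (Y := ⟨H.obj z', xx z'⟩) (H.map u) _ (hw u)
  let L : Z ⥤ D₁.Total :=
    { obj z := ⟨H.obj z, xx z⟩
      map u := m _ _ u
      map_id z := h.total_hom_ext ((hm _ _ _).1.trans (H.map_id z)) (by rw [(hm _ _ _).2]; simp)
      map_comp u u' := h.total_hom_ext ((hm _ _ _).1.trans ((H.map_comp u u').trans
        (congrArg₂ (· ≫ ·) (hm _ _ u).1.symm (hm _ _ u').1.symm)))
        (by rw [Functor.map_comp, (hm _ _ _).2, (hm _ _ _).2, (hm _ _ _).2]; simp) }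
  refine ⟨L, NatIso.ofComponents (fun z => Iso.refl (H.obj z)) ?_, NatIso.ofComponents j ?_, ?_⟩
  · intro z z' u
    exact (Category.comp_id _).trans ((hm _ _ u).1.symm.trans (Category.id_comp _).symm)
  · intro z z' u
    change FF.total.map (m _ _ u) ≫ (j z').hom = _
    rw [(hm _ _ u).2]
    simp
  · intro z
    change F.map (𝟙 _) ≫ (j z).hom.base = _
    rw [hj z, F.map_id]
    exact Category.id_comp _

end Plain

end DispFunctor

/-! ### Cartesian 1-cells in the displayed bicategory of arrows -/

section ArrowCartesian

variable {C₁ C₂ : Cat.{v, u}} {D₁ : DispCat.{v, u, v, u} C₁} {D₂ : DispCat.{v, u, v, u} C₂}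
  {F : C₁ ⟶ C₂} {FF : DispFunctor F.toFunctor D₁ D₂}

/-- An invertible 2-cell of `Cat` as a natural isomorphism. -/
def catIsoToNatIso {C D : Cat.{v, u}} {F G : C ⟶ D} (e : F ≅ G) : F.toFunctor ≅ G.toFunctor where
  hom := e.hom.toNatTrans
  inv := e.inv.toNatTrans
  hom_inv_id := congrArg (fun k => k.toNatTrans) e.hom_inv_id
  inv_hom_id := congrArg (fun k => k.toNatTrans) e.inv_hom_id

/-- A natural isomorphism as an invertible 2-cell of `Cat`. -/
def natIsoToCatIso {C D : Cat.{v, u}} {F G : C ⟶ D} (e : F.toFunctor ≅ G.toFunctor) : F ≅ G where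
  hom := ⟨e.hom⟩
  inv := ⟨e.inv⟩
  hom_inv_id := Cat.Hom₂.ext e.hom_inv_id
  inv_hom_id := Cat.Hom₂.ext e.inv_hom_id

theorem comp_totalSquare_iso_app {C : Cat.{v, u}} {z : ArrowObj C} {h : C ⟶ C₁}
    (s : ArrowHom h z (projArrow D₁)) (X : z.dom) :
    (s.comp (totalSquare FF)).iso.hom.toNatTrans.app X =
      F.toFunctor.map (s.iso.hom.toNatTrans.app X) := by
  change 𝟙 (F.toFunctor.obj (h.toFunctor.obj (z.arr.toFunctor.obj X))) ≫
    F.toFunctor.map (s.iso.hom.toNatTrans.app X) ≫ 𝟙 (F.toFunctor.obj _) ≫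
      𝟙 (F.toFunctor.obj _) ≫ 𝟙 (F.toFunctor.obj _) = _
  simp only [Category.id_comp, Category.comp_id]

/-- Compatibility with the squares forces the projection of a 2-cell to be `δ` conjugated by their
fillings. Once the base is fixed, full faithfulness supplies the unique preimage. -/
theorem bijective_whiskerRight_totalSquare (h : FF.FullyFaithful) {C : Cat.{v, u}}
    {z : ArrowObj C} {h₁ h₂ : C ⟶ C₁} (s₁ : ArrowHom h₁ z (projArrow D₁))
    (s₂ : ArrowHom h₂ z (projArrow D₁)) (δ : h₁ ⟶ h₂) :
    Function.Bijective (fun τ : ArrowHom₂ δ s₁ s₂ =>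
      (arrow Cat.{v, u}).whiskerRight τ (totalSquare FF)) := by
  rw [Function.bijective_iff_existsUnique]
  intro σ
  let e₁ := catIsoToNatIso s₁.iso
  let e₂ := catIsoToNatIso s₂.iso
  let d : z.arr.toFunctor ⋙ h₁.toFunctor ⟶ z.arr.toFunctor ⋙ h₂.toFunctor :=
    Functor.whiskerLeft z.arr.toFunctor δ.toNatTrans
  let β : s₁.top.toFunctor ⋙ D₁.proj ⟶ s₂.top.toFunctor ⋙ D₁.proj := e₁.inv ≫ d ≫ e₂.hom
  have hβ (t : s₁.top ⟶ s₂.top) :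
      (s₁.iso.hom ≫ t ▷ (projArrow D₁).arr = z.arr ◁ δ ≫ s₂.iso.hom) ↔
        ∀ X, D₁.proj.map (t.toNatTrans.app X) = β.app X :=
    ⟨fun hc X => (Iso.eq_inv_comp (e₁.app X)).2 (congrArg (fun k => k.toNatTrans.app X) hc),
      fun ht => Cat.Hom₂.ext <| NatTrans.ext <| funext fun X =>
        (Iso.eq_inv_comp (e₁.app X)).1 (ht X)⟩
  -- The compatibility of `σ` is the `F`-image of the equation defining `β`, after cancelling the
  -- invertible `F.map (e₁.hom.app X)`.
  have w : ∀ X, D₂.proj.map (σ.top.toNatTrans.app X) = F.toFunctor.map (β.app X) := by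
    intro X
    have hc : (s₁.comp (totalSquare FF)).iso.hom.toNatTrans.app X ≫
        D₂.proj.map (σ.top.toNatTrans.app X) = F.toFunctor.map (d.app X) ≫
          (s₂.comp (totalSquare FF)).iso.hom.toNatTrans.app X :=
      congrArg (fun k => k.toNatTrans.app X) σ.comm
    rw [comp_totalSquare_iso_app, comp_totalSquare_iso_app] at hc
    have hd : d.app X ≫ e₂.hom.app X = e₁.hom.app X ≫ β.app X :=
      ((Iso.eq_inv_comp (e₁.app X)).1 rfl).symm
    refine (cancel_epi (F.toFunctor.map (e₁.hom.app X))).1 (hc.trans ?_)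
    exact (F.toFunctor.map_comp _ _).symm.trans
      ((congrArg F.toFunctor.map hd).trans (F.toFunctor.map_comp _ _))
  obtain ⟨t, ⟨ht, ht'⟩, hu⟩ := h.existsUnique_whiskerRight_total β σ.top.toNatTrans w
  refine ⟨⟨⟨t⟩, (hβ ⟨t⟩).2 ht⟩, ArrowHom₂.ext (Cat.Hom₂.ext ht'), fun s hs => ?_⟩
  refine ArrowHom₂.ext (Cat.Hom₂.ext (hu _ ⟨(hβ s.top).1 s.comm, ?_⟩))
  exact congrArg (fun k => k.top.toNatTrans) hs

theorem nonempty_lift_totalSquare (h : FF.FullyFaithful) (hs : FF.EssSurj)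
    (hi : D₂.IsIsofibration) {C : Cat.{v, u}} {z : ArrowObj C} (k : C ⟶ C₁)
    (g : ArrowHom (k ≫ F) z (projArrow D₂)) :
    Nonempty (DispBicat.Lift (D := arrow Cat.{v, u}) (totalSquare FF) k g) := by
  obtain ⟨L, i, j, hij⟩ := h.exists_total_lift hs hi (z.arr.toFunctor ⋙ k.toFunctor)
    g.top.toFunctor (catIsoToNatIso g.iso)
  let s : ArrowHom k z (projArrow D₁) := ⟨⟨L⟩, natIsoToCatIso i⟩
  let e : (s.comp (totalSquare FF)).top ≅ g.top := natIsoToCatIso j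
  have comm : (s.comp (totalSquare FF)).iso.hom ≫ e.hom ▷ (projArrow D₂).arr =
      z.arr ◁ (Iso.refl (k ≫ F)).hom ≫ g.iso.hom :=
    Cat.Hom₂.ext <| NatTrans.ext <| funext fun X =>
      ((congrArg (· ≫ D₂.proj.map (j.hom.app X)) (comp_totalSquare_iso_app s X)).trans
        (hij X)).trans (Category.id_comp _).symm
  exact ⟨⟨s, ⟨⟨e.hom, comm⟩, ⟨e.inv, ArrowHom₂.comm_inv (Iso.refl (k ≫ F)) e comm⟩,
    ArrowHom₂.hext (Iso.hom_inv_id _) (Iso.hom_inv_id _),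
    ArrowHom₂.hext (Iso.inv_hom_id _) (Iso.inv_hom_id _)⟩⟩⟩

theorem totalSquare_cartesianStructure (h : FF.FullyFaithful) (hs : FF.EssSurj)
    (hi : D₂.IsIsofibration) :
    Nonempty (DispBicat.CartesianStructure (D := arrow Cat.{v, u}) (totalSquare FF)) :=
  ⟨DispBicat.CartesianStructure.ofBijective
    (fun k g => (nonempty_lift_totalSquare h hs hi k g).some)
    (fun s₁ s₂ δ => bijective_whiskerRight_totalSquare h s₁ s₂ δ)⟩

end ArrowCartesian

end CompBicat

/-! ### The two comprehension bicategories -/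

theorem mainTheorem4 :
    (∃ χ : CompBicat.DispPseudofunctor (Pseudofunctor.id Cat.{v, u}) CompBicat.OpCleav.{v, u}
        (CompBicat.arrow Cat.{v, u}),
      χ.toDispCellMap = CompBicat.opCleavCellMap.{v, u} ∧
        Nonempty (CompBicat.ComprehensionBicat χ)) ∧
    (∃ χ : CompBicat.DispPseudofunctor (Pseudofunctor.id Cat.{v, u}) CompBicat.Cleav.{v, u}
        (CompBicat.arrow Cat.{v, u}),
      χ.toDispCellMap = CompBicat.cleavCellMap.{v, u} ∧
        Nonempty (CompBicat.ContravariantComprehensionBicat χ)) := by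
  refine ⟨⟨CompBicat.opCleavPseudofunctor, rfl, ⟨?_⟩⟩, ⟨CompBicat.cleavPseudofunctor, rfl, ⟨?_⟩⟩⟩
  · exact
      { globalCleaving := CompBicat.opCleavGlobalCleaving
        localOpcleaving := CompBicat.opCleavLocalOpcleaving
        whiskerLeft_opcartesian := CompBicat.opCleav_whiskerLeft_isOpcartesian₂
        whiskerRight_opcartesian := CompBicat.opCleav_whiskerRight_isOpcartesian₂
        -- The opcleaving of the target enters here only through the lifting of isomorphisms.
        preservesCartesian := fun _ ⟨s⟩ => CompBicat.totalSquare_cartesianStructure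
          (CompBicat.fullyFaithful_of_opCleav s) (CompBicat.essSurj_of_opCleav s)
          (CompBicat.DispCat.OpCleaving.isIsofibration (Sigma.snd _))
        preservesOpcartesian₂ := fun {_ _ _ _ _ _ _ _ _} θθ h {_ _} τ γγ => CompBicat.totalSquare₂_isOpcartesian₂ θθ
          (fun xx => CompBicat.isOpcartesian_app_of_isOpcartesian₂ θθ h xx) τ γγ }
  · exact
      { globalCleaving := CompBicat.cleavGlobalCleaving
        localCleaving := CompBicat.cleavLocalCleaving
        whiskerLeft_cartesian := CompBicat.cleav_whiskerLeft_isCartesian₂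
        whiskerRight_cartesian := CompBicat.cleav_whiskerRight_isCartesian₂
        preservesCartesian := fun _ ⟨s⟩ => CompBicat.totalSquare_cartesianStructure
          (CompBicat.fullyFaithful_of_cleav s) (CompBicat.essSurj_of_cleav s)
          (CompBicat.DispCat.Cleaving.isIsofibration (Sigma.snd _))
        preservesCartesian₂ := fun {_ _ _ _ _ _ _ _ _} θθ h {_ _} τ γγ => CompBicat.totalSquare₂_isCartesian₂ θθ
          (fun xx => CompBicat.isCartesian_app_of_isCartesian₂ θθ h xx) τ γγ }
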